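/- Let $SU(1,1)$ be the group of matrices $g=\begin{pmatrix}a&b\\ \bar b&\bar a\end{pmatrix}$ with $|a|^2-|b|^2=1$, and write $g\cdot\alpha=a\alpha+b\bar\alpha$ for $\alpha\in\mathbb C$. Let $G^J_1=SU(1,1)\times\mathbb C\times\mathbb R$ be the Jacobi group, with the product $$(g_1,\alpha_1,t_1)(g_2,\alpha_2,t_2)=\bigl(g_1g_2,\ g_2^{-1}\cdot\alpha_1+\alpha_2,\ t_1+t_2+\operatorname{Im}((g_2^{-1}\cdot\alpha_1)\bar\alpha_2)\bigr),$$ and let $\mathcal D^J_1=\{(z,w)\in\mathbb C^2: |w|<1\}$ be the Siegel--Jacobi disk. For $(g,\alpha,t)\in G^J_1$ and $(z,w)\in\mathcal D^J_1$ put $$\delta=\bar b w+\bar a,\quad \gamma=z+\alpha-\bar\alpha w,\quad z_1=\frac{\gamma}{\delta},\quad w_1=\frac{aw+b}{\delta}.$$ (i) One has $\delta\neq0$, and $(g,\alpha,t)\cdot(z,w)=(z_1,w_1)$ defines a continuous, transitive action of $G^J_1$ on $\mathcal D^J_1$ by holomorphic maps. The elements that act trivially are exactly the central ones $(1,0,t)$,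 $t\in\mathbb R$. (ii) Let $\mu>0$ and let $k>0$ with $2k\in\{2,3,\dots\}$. Let $\pi$ be a continuous unitary representation of $G^J_1$ on a complex Hilbert space with $\pi(1,0,t)=e^{i\mu t}$. Define operators $K_0,K_\pm,a,a^\dagger$ on its smooth vectors through the derived representation: $2iK_0$, $K_+-K_-$, $i(K_++K_-)$ are the generators of the one-parameter groups $\pi(\exp(sX),0,0)$ with $X=\operatorname{diag}(i,-i)$, $\begin{pmatrix}0&1\\1&0\end{pmatrix}$, $\begin{pmatrix}0&i\\-i&0\end{pmatrix}$, and $\sqrt\mu(a^\dagger-a)$, $i\sqrt\mu(a^\dagger+a)$ are those of $\pi(1,s,0)$, $\pi(1,is,0)$. Let $e_0$ be a smooth unit vector with $a e_0=0$, $K_-e_0=0$, $K_0e_0=ke_0$. Put $S_k(g)=\pi(g,0,0)$, $D_\mu(\alpha)=\pi(1,\alpha,0)$, $\beta_\mu(\alpha,t)=e^{i\mu t}D_\mu(\alpha)$, $T_{k\mu}(g,\alpha,t)=S_k(g)\beta_\mu(\alpha,t)$, and $$e_{z,w}=\exp(\sqrt\mu\, z a^\dagger+wK_+)e_0=\sum_{j\ge0}\frac1{j!}(\sqrt\mu\,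 z a^\dagger+wK_+)^je_0 .$$ Then $D_\mu(\alpha)=\exp\bigl(\sqrt\mu(\alpha a^\dagger-\bar\alpha a)\bigr)$, in the sense that $\frac{d}{ds}\big|_{s=0}D_\mu(s\alpha)v=\sqrt\mu(\alpha a^\dagger-\bar\alpha a)v$ for all smooth vectors $v$; $T_{k\mu}=\pi$; for all $(z,w)\in\mathcal D^J_1$ the terms of the series are smooth vectors and the series converges; and for all $g\in SU(1,1)$, $\alpha\in\mathbb C$, $t\in\mathbb R$, $(z,w)\in\mathcal D^J_1$, $$S_k(g)D_\mu(\alpha)e_{z,w}=\lambda\,e_{z_1,w_1},\qquad T_{k\mu}(g,\alpha,t)e_{z,w}=\lambda e^{i\mu t}e_{z_1,w_1},$$ $$\lambda=\delta^{-2k}\exp\bigl(-\tfrac12\mu\lambda_1\bigr),\qquad \lambda_1=\bar\alpha(z+\gamma)+\frac{\bar b\gamma^2}{\delta}.$$ -/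

import Mathlib

open scoped ContDiff ComplexConjugate

noncomputable section

namespace SiegelJacobi

/-- The group `SU(1,1)`: the matrices `!![a, b; conj b, conj a]` with `|a|² - |b|² = 1`. -/
@[ext]
structure SU11 where
  a : ℂ
  b : ℂ
  norm_sub : ‖a‖ ^ 2 - ‖b‖ ^ 2 = 1

namespace SU11

theorem mul_conj_sub (g : SU11) : g.a * conj g.a - g.b * conj g.b = 1 := by
  rw [Complex.mul_conj', Complex.mul_conj']
  exact_mod_cast g.norm_sub

theorem norm_sub_of {a b : ℂ} (h : a * conj a - b * conj b = 1) : ‖a‖ ^ 2 - ‖b‖ ^ 2 = 1 := by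
  rw [Complex.mul_conj', Complex.mul_conj'] at h
  exact_mod_cast h

/-- The matrix of an element of `SU(1,1)`. -/
def toMatrix (g : SU11) : Matrix (Fin 2) (Fin 2) ℂ := !![g.a, g.b; conj g.b, conj g.a]

instance : One SU11 := ⟨⟨1, 0, by simp⟩⟩

instance : Mul SU11 :=
  ⟨fun g h => ⟨g.a * h.a + g.b * conj h.b, g.a * h.b + g.b * conj h.a, norm_sub_of (by
    have hg := g.mul_conj_sub
    have hh := h.mul_conj_sub
    simp only [map_add, map_mul, Complex.conj_conj]
    linear_combination hg * (h.a * conj h.a - h.b * conj h.b) + hh)⟩⟩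

instance : Inv SU11 :=
  ⟨fun g => ⟨conj g.a, -g.b, by simpa using g.norm_sub⟩⟩

@[simp] theorem one_a : (1 : SU11).a = 1 := rfl
@[simp] theorem one_b : (1 : SU11).b = 0 := rfl
@[simp] theorem mul_a (g h : SU11) : (g * h).a = g.a * h.a + g.b * conj h.b := rfl
@[simp] theorem mul_b (g h : SU11) : (g * h).b = g.a * h.b + g.b * conj h.a := rfl
@[simp] theorem inv_a (g : SU11) : g⁻¹.a = conj g.a := rfl
@[simp] theorem inv_b (g : SU11) : g⁻¹.b = -g.b := rfl

/-- The multiplication is that of matrices. -/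
theorem toMatrix_mul (g h : SU11) : (g * h).toMatrix = g.toMatrix * h.toMatrix := by
  ext i j
  fin_cases i <;> fin_cases j <;> simp [toMatrix, Matrix.mul_apply, Fin.sum_univ_two] <;> ring

instance : Group SU11 :=
  Group.ofLeftAxioms
    (fun g h l => by ext <;> simp <;> ring)
    (fun g => by ext <;> simp)
    (fun g => by
      have hg := g.mul_conj_sub
      ext
      · simp
        linear_combination hg
      · simp
        ring)

/-- The real-linear action `α ↦ a α + b ᾱ` of `SU(1,1)` on `ℂ`. -/
def lin (g : SU11) (α : ℂ) : ℂ := g.a * α + g.b * conj α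

/-- The one-parameter subgroup of `SU(1,1)` generated by `2 i K₀`, i.e. by `diag (i, -i)`. -/
def rot (t : ℝ) : SU11 :=
  ⟨Complex.exp (t * Complex.I), 0, by simp [Complex.norm_exp_ofReal_mul_I]⟩

/-- The one-parameter subgroup of `SU(1,1)` generated by `K₊ - K₋`, i.e. by `!![0, 1; 1, 0]`. -/
def hyp (t : ℝ) : SU11 :=
  ⟨Real.cosh t, Real.sinh t, by
    simp only [Complex.norm_real, Real.norm_eq_abs, sq_abs]
    exact Real.cosh_sq_sub_sinh_sq t⟩

/-- The one-parameter subgroup of `SU(1,1)` generated by `i K₊ + i K₋`, i.e. by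
`!![0, i; -i, 0]`. -/
def hyp' (t : ℝ) : SU11 :=
  ⟨Real.cosh t, Complex.I * Real.sinh t, by
    simp only [norm_mul, Complex.norm_I, one_mul, Complex.norm_real, Real.norm_eq_abs, sq_abs]
    exact Real.cosh_sq_sub_sinh_sq t⟩

/-- The smooth retraction of the open set `|b| < |a|` of `ℂ²` onto `SU(1,1)`, dividing `(a, b)` by
`√(|a|² - |b|²)` (and `1` off that open set). -/
def normalize (a b : ℂ) : SU11 :=
  if h : ‖b‖ < ‖a‖ then
    ⟨a / (Real.sqrt (‖a‖ ^ 2 - ‖b‖ ^ 2) : ℝ), b / (Real.sqrt (‖a‖ ^ 2 - ‖b‖ ^ 2) : ℝ), by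
      have hp : 0 < ‖a‖ ^ 2 - ‖b‖ ^ 2 := by
        have := norm_nonneg b
        nlinarith
      simp only [norm_div, Complex.norm_real, Real.norm_eq_abs, div_pow, sq_abs,
        Real.sq_sqrt hp.le]
      rw [← sub_div, div_self hp.ne']⟩
  else 1

end SU11

/-- The Jacobi group `G^J_1 = H_1 ⋊ SU(1,1)`, an element being written as
`(g, α, t) = (g, 0, 0) (1, α, t)`, with `(α, t)` in the Heisenberg group `H_1 = ℂ × ℝ`. -/
@[ext]
structure JacobiGroup where
  g : SU11
  α : ℂ
  t : ℝ

namespace JacobiGroup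

instance : One JacobiGroup := ⟨⟨1, 0, 0⟩⟩

/-- `(g₁, α₁, t₁) (g₂, α₂, t₂) =
(g₁ g₂, g₂⁻¹ · α₁ + α₂, t₁ + t₂ + Im ((g₂⁻¹ · α₁) ᾱ₂))`. -/
instance : Mul JacobiGroup :=
  ⟨fun x y => ⟨x.g * y.g, y.g⁻¹.lin x.α + y.α, x.t + y.t + (y.g⁻¹.lin x.α * conj y.α).im⟩⟩

instance : Inv JacobiGroup := ⟨fun x => ⟨x.g⁻¹, -x.g.lin x.α, -x.t⟩⟩

@[simp] theorem one_g : (1 : JacobiGroup).g = 1 := rfl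
@[simp] theorem one_α : (1 : JacobiGroup).α = 0 := rfl
@[simp] theorem one_t : (1 : JacobiGroup).t = 0 := rfl
@[simp] theorem mul_g (x y : JacobiGroup) : (x * y).g = x.g * y.g := rfl
@[simp] theorem mul_α (x y : JacobiGroup) : (x * y).α = y.g⁻¹.lin x.α + y.α := rfl
@[simp] theorem mul_t (x y : JacobiGroup) :
    (x * y).t = x.t + y.t + (y.g⁻¹.lin x.α * conj y.α).im := rfl
@[simp] theorem inv_g (x : JacobiGroup) : x⁻¹.g = x.g⁻¹ := rfl
@[simp] theorem inv_α (x : JacobiGroup) : x⁻¹.α = -x.g.lin x.α := rfl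
@[simp] theorem inv_t (x : JacobiGroup) : x⁻¹.t = -x.t := rfl

theorem im_lin (g : SU11) (x y : ℂ) : (g.lin x * conj (g.lin y)).im = (x * conj y).im := by
  have h := g.norm_sub
  rw [← Complex.normSq_eq_norm_sq, ← Complex.normSq_eq_norm_sq] at h
  simp only [Complex.normSq_apply] at h
  simp only [SU11.lin, Complex.mul_im, Complex.add_im, Complex.add_re, Complex.mul_re,
    Complex.conj_re, Complex.conj_im]
  linear_combination (x.im * y.re - x.re * y.im) * h

theorem lin_mul (g h : SU11) (x : ℂ) : (g * h).lin x = g.lin (h.lin x) := by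
  simp [SU11.lin]; ring

theorem lin_add (g : SU11) (x y : ℂ) : g.lin (x + y) = g.lin x + g.lin y := by
  simp [SU11.lin]; ring

instance : Group JacobiGroup :=
  Group.ofLeftAxioms
    (fun x y z => by
      ext1
      · simp [mul_assoc]
      · simp only [mul_α, mul_g, mul_inv_rev, lin_mul, lin_add, add_assoc]
      · have h := im_lin z.g⁻¹ (y.g⁻¹.lin x.α) y.α
        simp only [mul_t, mul_α, mul_g, mul_inv_rev, lin_mul, lin_add, map_add, mul_add, add_mul,
          Complex.add_im]
        rw [← h]
        ring)
    (fun x => by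
      ext1 <;> simp [SU11.lin])
    (fun x => by
      have h : x.g⁻¹.lin (-x.g.lin x.α) = -x.α := by
        rw [show -x.g.lin x.α = x.g.lin (-x.α) by simp [SU11.lin]; ring, ← lin_mul,
          inv_mul_cancel]
        simp [SU11.lin]
      ext1
      · simp
      · simp [h]
      · simp [h, Complex.mul_conj])

/-- The topology of `G^J_1` as a subset of `ℂ × ℂ × ℂ × ℝ`. -/
instance : TopologicalSpace JacobiGroup :=
  TopologicalSpace.induced (fun x => (x.g.a, x.g.b, x.α, x.t)) inferInstance

/-- The element `g` of the subgroup `SU(1,1)` of `G^J_1`. -/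
def ofSU (g : SU11) : JacobiGroup := ⟨g, 0, 0⟩

/-- The element `(α, t)` of the subgroup `H_1` of `G^J_1`. -/
def ofH (α : ℂ) (t : ℝ) : JacobiGroup := ⟨1, α, t⟩

end JacobiGroup

/-- The Siegel-Jacobi disk `ℂ × {|w| < 1}`. -/
def disk : Set (ℂ × ℂ) := {p | ‖p.2‖ < 1}

/-- `δ = b̄ w + ā`. -/
def delta (g : SU11) (w : ℂ) : ℂ := conj g.b * w + conj g.a

/-- `γ = z + α - ᾱ w`. -/
def gam (α z w : ℂ) : ℂ := z + α - conj α * w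

/-- `z₁ = γ / δ`. -/
def z₁ (g : SU11) (α z w : ℂ) : ℂ := gam α z w / delta g w

/-- `w₁ = g · w = (a w + b) / δ`. -/
def w₁ (g : SU11) (w : ℂ) : ℂ := (g.a * w + g.b) / delta g w

/-- `λ₁ = ᾱ (z + γ) + b̄ γ² / δ`. -/
def lam₁ (g : SU11) (α z w : ℂ) : ℂ :=
  conj α * (z + gam α z w) + conj g.b * gam α z w ^ 2 / delta g w

/-- `λ = δ^{-2k} exp (-½ μ λ₁)`, where `n = 2k`. -/
def lam (n : ℕ) (μ : ℝ) (g : SU11) (α z w : ℂ) : ℂ :=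
  (delta g w ^ n)⁻¹ * Complex.exp (-(1 / 2) * μ * lam₁ g α z w)

/-- The transformation `(z, w) ↦ (z₁, w₁)` attached to `(g, α, t)`. -/
def act (x : JacobiGroup) (p : ℂ × ℂ) : ℂ × ℂ := (z₁ x.g x.α p.1 p.2, w₁ x.g p.2)

section Representation

variable {H : Type*} [NormedAddCommGroup H] [InnerProductSpace ℂ H] [CompleteSpace H]

/-- `v` is a smooth vector of `π`: the orbit map `x ↦ π x v` is smooth on `G^J_1`. Smoothness on
`G^J_1` is tested after composition with the smooth retraction of the open set `|b| < |a|` of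
`ℂ × ℂ × ℂ × ℝ` (coordinates `a, b, α, t`) onto its closed submanifold `G^J_1`. -/
def IsSmoothVector (π : JacobiGroup →* unitary (H →L[ℂ] H)) (v : H) : Prop :=
  ContDiffOn ℝ ∞
    (fun p : ℂ × ℂ × ℂ × ℝ =>
      (π ⟨SU11.normalize p.1 p.2.1, p.2.2.1, p.2.2.2⟩ : H →L[ℂ] H) v)
    {p | ‖p.2.1‖ < ‖p.1‖}

/-- The derived representation: the derivative at `t = 0` of `π (γ t) v`, where `γ` is a
one-parameter subgroup. It is meant for smooth vectors `v`. -/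
def dpi (π : JacobiGroup →* unitary (H →L[ℂ] H)) (γ : ℝ → JacobiGroup) (v : H) : H :=
  deriv (fun t : ℝ => (π (γ t) : H →L[ℂ] H) v) 0

/-- `K₀`, where `2 i K₀` is the generator of `rot`. -/
def K₀ (π : JacobiGroup →* unitary (H →L[ℂ] H)) (v : H) : H :=
  (-Complex.I / 2) • dpi π (fun t => .ofSU (.rot t)) v

/-- `K₊`, where `K₊ - K₋` and `i (K₊ + K₋)` are the generators of `hyp` and `hyp'`. -/
def Kplus (π : JacobiGroup →* unitary (H →L[ℂ] H)) (v : H) : H :=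
  (1 / 2 : ℂ) • (dpi π (fun t => .ofSU (.hyp t)) v -
    Complex.I • dpi π (fun t => .ofSU (.hyp' t)) v)

/-- `K₋`, where `K₊ - K₋` and `i (K₊ + K₋)` are the generators of `hyp` and `hyp'`. -/
def Kminus (π : JacobiGroup →* unitary (H →L[ℂ] H)) (v : H) : H :=
  (-1 / 2 : ℂ) • (dpi π (fun t => .ofSU (.hyp t)) v +
    Complex.I • dpi π (fun t => .ofSU (.hyp' t)) v)

/-- The creation operator `a†`, where `√μ (a† - a)` and `i √μ (a† + a)` are the generators of the
one-parameter groups `t ↦ (1, t, 0)` and `t ↦ (1, i t, 0)`. -/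
def creation (μ : ℝ) (π : JacobiGroup →* unitary (H →L[ℂ] H)) (v : H) : H :=
  (1 / (2 * Real.sqrt μ : ℝ) : ℂ) • (dpi π (fun t => .ofH t 0) v -
    Complex.I • dpi π (fun t => .ofH (Complex.I * t) 0) v)

/-- The annihilation operator `a`, where `√μ (a† - a)` and `i √μ (a† + a)` are the generators of
the one-parameter groups `t ↦ (1, t, 0)` and `t ↦ (1, i t, 0)`. -/
def annihilation (μ : ℝ) (π : JacobiGroup →* unitary (H →L[ℂ] H)) (v : H) : H :=
  (-1 / (2 * Real.sqrt μ : ℝ) : ℂ) • (dpi π (fun t => .ofH t 0) v +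
    Complex.I • dpi π (fun t => .ofH (Complex.I * t) 0) v)

/-- `π` is a continuous unitary representation of `G^J_1` with central character `e^{iμt}`, and
`e₀` is a normalized extremal weight vector: a smooth vector with `a e₀ = 0`, `K₋ e₀ = 0` and
`K₀ e₀ = k e₀`. -/
structure IsExtremalWeight (k μ : ℝ) (π : JacobiGroup →* unitary (H →L[ℂ] H)) (e₀ : H) :
    Prop where
  continuous : ∀ v : H, Continuous fun x => (π x : H →L[ℂ] H) v
  central : ∀ (t : ℝ) (v : H),
    (π (.ofH 0 t) : H →L[ℂ] H) v = Complex.exp (Complex.I * μ * t) • v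
  norm_eq : ‖e₀‖ = 1
  smooth : IsSmoothVector π e₀
  annihilation_eq : annihilation μ π e₀ = 0
  Kminus_eq : Kminus π e₀ = 0
  K₀_eq : K₀ π e₀ = (k : ℂ) • e₀

/-- `S(g)`, the restriction of the representation to `SU(1,1)`. -/
def S (π : JacobiGroup →* unitary (H →L[ℂ] H)) (g : SU11) : H →L[ℂ] H := π (.ofSU g)

/-- The displacement operator `D(α)`, i.e. the value at `t = 1` of the unitary one-parameter group
`t ↦ π (1, t α, 0)`, whose generator is `√μ (α a† - ᾱ a)`. -/
def D (π : JacobiGroup →* unitary (H →L[ℂ] H)) (α : ℂ) : H →L[ℂ] H := π (.ofH α 0)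

/-- `β(α, t) = e^{iμt} D(α)`. -/
def beta (μ : ℝ) (π : JacobiGroup →* unitary (H →L[ℂ] H)) (α : ℂ) (t : ℝ) : H →L[ℂ] H :=
  Complex.exp (Complex.I * μ * t) • D π α

/-- `T(g, α, t) = S(g) β(α, t)`. -/
def T (μ : ℝ) (π : JacobiGroup →* unitary (H →L[ℂ] H)) (x : JacobiGroup) : H →L[ℂ] H :=
  (S π x.g).comp (beta μ π x.α x.t)

/-- The `j`-th term `X^j e₀ / j!` of the exponential series of
`e_{z,w} = exp (√μ z a† + w K₊) e₀`. -/
def coherentTerm (μ : ℝ) (π : JacobiGroup →* unitary (H →L[ℂ] H)) (e₀ : H) (z w : ℂ) (j : ℕ) :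
    H :=
  (j.factorial : ℂ)⁻¹ •
    (fun v => ((Real.sqrt μ : ℂ) * z) • creation μ π v + w • Kplus π v)^[j] e₀

/-- Perelomov's coherent state vector `e_{z,w} = exp (√μ z a† + w K₊) e₀`. -/
def coherent (μ : ℝ) (π : JacobiGroup →* unitary (H →L[ℂ] H)) (e₀ : H) (z w : ℂ) : H :=
  ∑' j : ℕ, coherentTerm μ π e₀ z w j

end Representation

end SiegelJacobi

end

noncomputable section

namespace SiegelJacobi

/-! The coherent vector is identified with a vector obtained by transporting `e₀` with the group;
the transformation law is then an equivariance.

The factor `mult`, i.e. λ e^{iμt}, is a multiplicative cocycle for the action (`mult_mul`). The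
stabilizer of the origin consists of rotations times the centre, and there `e₀` is an eigenvector
with character `mult n μ · 0`: this is `K₀ e₀ = k e₀` integrated along the rotations, together with
the central character (`stabilizer_apply`). Hence E(p) = mult(x, 0)⁻¹ π(x) e₀ depends only on p =
x·0, and π(x) E(p) = mult(x, p) E(x·p) (`apply_orbitFamily`). This E is `orbitFamily`, written with
an explicit smooth section of the orbit map.

Differentiating the equivariance along one-parameter subgroups turns the generators into first-order
differential operators on E. At the origin, `a e₀ = 0` and `K₋ e₀ = 0` become the Cauchy–Riemann
equations in z and in w; equivariance carries holomorphy to the whole disk. With holomorphy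
available, the multiplier terms cancel and √μ z a† + w K₊ acts on E(p) as the derivative in the
direction (z, w) (`raising_orbitFamily`).

Along F(s) = E(sz, sw) the raising operator is therefore d/ds. It commutes with d/ds because mixed
partial derivatives of smooth orbit maps agree, so its j-th power on `e₀` is the j-th derivative of
F at 0 (`iterate_raising`). Since F is holomorphic on a disc of radius greater than 1, the
exponential series is the Taylor series of F at s = 1 and converges to E(z, w)
(`hasSum_coherentTerm`). -/

/-! ### The action on the disk and its automorphy factor -/

theorem normSq_delta_sub (g : SU11) (w : ℂ) :
    ‖delta g w‖ ^ 2 - ‖g.a * w + g.b‖ ^ 2 = 1 - ‖w‖ ^ 2 := by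
  have h := g.mul_conj_sub
  have : ((‖delta g w‖ ^ 2 - ‖g.a * w + g.b‖ ^ 2 : ℝ) : ℂ) = ((1 - ‖w‖ ^ 2 : ℝ) : ℂ) := by
    push_cast
    rw [← Complex.mul_conj', ← Complex.mul_conj', ← Complex.mul_conj']
    simp only [delta, map_add, map_mul, Complex.conj_conj]
    linear_combination (1 - w * conj w) * h
  exact_mod_cast this

/-- The matrix sends (w, 1) to (aw + b, δ) and preserves the Hermitian form of signature (1,1); its
value 1 - |w|² is positive, which excludes δ = 0. -/
theorem delta_ne_zero (g : SU11) {w : ℂ} (hw : ‖w‖ < 1) : delta g w ≠ 0 := by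
  intro h0
  have h := normSq_delta_sub g w
  rw [h0, norm_zero] at h
  nlinarith [norm_nonneg w, sq_nonneg ‖g.a * w + g.b‖]

theorem norm_w₁_lt (g : SU11) {w : ℂ} (hw : ‖w‖ < 1) : ‖w₁ g w‖ < 1 := by
  have h := normSq_delta_sub g w
  have hd := norm_pos_iff.2 (delta_ne_zero g hw)
  rw [w₁, norm_div, div_lt_one hd]
  refine lt_of_pow_lt_pow_left₀ 2 hd.le ?_
  nlinarith [norm_nonneg w]

theorem act_mem_disk (x : JacobiGroup) {p : ℂ × ℂ} (hp : p ∈ disk) : act x p ∈ disk :=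
  norm_w₁_lt x.g hp

theorem act_one (p : ℂ × ℂ) : act 1 p = p := by
  simp [act, z₁, w₁, gam, delta]

theorem delta_mul (g h : SU11) {w : ℂ} (hw : ‖w‖ < 1) :
    delta (g * h) w = delta g (w₁ h w) * delta h w := by
  have hd := delta_ne_zero h hw
  have : w₁ h w * delta h w = h.a * w + h.b := div_mul_cancel₀ _ hd
  have e : delta g (w₁ h w) * delta h w
      = conj g.b * (w₁ h w * delta h w) + conj g.a * delta h w := by
    simp only [delta]; ring
  rw [e, this]
  simp only [delta, SU11.mul_a, SU11.mul_b, map_add, map_mul, Complex.conj_conj]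
  ring

theorem w₁_mul (g h : SU11) {w : ℂ} (hw : ‖w‖ < 1) : w₁ (g * h) w = w₁ g (w₁ h w) := by
  have hd := delta_ne_zero h hw
  have e : w₁ h w * delta h w = h.a * w + h.b := div_mul_cancel₀ _ hd
  have e' : (g * h).a * w + (g * h).b = (g.a * w₁ h w + g.b) * delta h w := by
    rw [add_mul, mul_assoc, e]
    simp only [delta, SU11.mul_a, SU11.mul_b]
    ring
  rw [w₁, delta_mul g h hw, e', mul_div_mul_right _ _ hd, ← w₁]

/-- The numerator γ picks up the same factor δ as the denominator does in `delta_mul`, so the two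
cancel in `z₁`. -/
theorem gam_mul (x y : JacobiGroup) {z w : ℂ} (hw : ‖w‖ < 1) :
    gam (x * y).α z w = gam x.α (z₁ y.g y.α z w) (w₁ y.g w) * delta y.g w := by
  have hd := delta_ne_zero y.g hw
  have e : w₁ y.g w * delta y.g w = y.g.a * w + y.g.b := div_mul_cancel₀ _ hd
  have e' : z₁ y.g y.α z w * delta y.g w = gam y.α z w := div_mul_cancel₀ _ hd
  rw [gam, gam, sub_mul, add_mul, mul_assoc, e, e', gam]
  simp only [delta, JacobiGroup.mul_α, SU11.lin, SU11.inv_a, SU11.inv_b, map_add, map_mul, map_neg,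
    Complex.conj_conj]
  ring

theorem act_mul (x y : JacobiGroup) {p : ℂ × ℂ} (hp : p ∈ disk) :
    act (x * y) p = act x (act y p) := by
  have hd := delta_ne_zero y.g hp
  refine Prod.ext ?_ (w₁_mul x.g y.g hp)
  simp only [act]
  rw [z₁, gam_mul x y hp, JacobiGroup.mul_g, delta_mul _ _ hp, mul_div_mul_right _ _ hd, ← z₁]

/-- The full automorphy factor `λ e^{iμt}` of `(g, α, t)`. -/
def mult (n : ℕ) (μ : ℝ) (x : JacobiGroup) (p : ℂ × ℂ) : ℂ :=
  lam n μ x.g x.α p.1 p.2 * Complex.exp (Complex.I * μ * x.t)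

theorem mult_ne_zero (n : ℕ) (μ : ℝ) (x : JacobiGroup) {p : ℂ × ℂ} (hp : p ∈ disk) :
    mult n μ x p ≠ 0 :=
  mul_ne_zero (mul_ne_zero (inv_ne_zero (pow_ne_zero _ (delta_ne_zero x.g hp)))
    (Complex.exp_ne_zero _)) (Complex.exp_ne_zero _)

theorem mult_one (n : ℕ) (μ : ℝ) (p : ℂ × ℂ) : mult n μ 1 p = 1 := by
  simp [mult, lam, lam₁, delta, gam]

/-- The exponent fails to be an additive cocycle exactly by the symplectic term of the Heisenberg
product; in `mult_mul` the phase e^{iμt} absorbs it. -/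
theorem lam₁_mul (x y : JacobiGroup) {z w : ℂ} (hw : ‖w‖ < 1) :
    lam₁ (x * y).g (x * y).α z w -
        2 * Complex.I * ((y.g⁻¹.lin x.α * conj y.α).im : ℝ) =
      lam₁ x.g x.α (z₁ y.g y.α z w) (w₁ y.g w) + lam₁ y.g y.α z w := by
  have hd := delta_ne_zero y.g hw
  have hd1 := delta_ne_zero x.g (norm_w₁_lt y.g hw)
  have e : w₁ y.g w * delta y.g w = y.g.a * w + y.g.b := div_mul_cancel₀ _ hd
  have e' : z₁ y.g y.α z w * delta y.g w = gam y.α z w := div_mul_cancel₀ _ hd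
  have him : 2 * Complex.I * ((y.g⁻¹.lin x.α * conj y.α).im : ℝ) =
      y.g⁻¹.lin x.α * conj y.α - conj (y.g⁻¹.lin x.α) * y.α := by
    rw [Complex.im_eq_sub_conj]
    simp only [map_mul, Complex.conj_conj]
    field_simp
  rw [him, lam₁, lam₁, lam₁, gam_mul x y hw, JacobiGroup.mul_g, delta_mul _ _ hw, ← e']
  simp only [JacobiGroup.mul_α, SU11.mul_b, SU11.lin, SU11.inv_a, SU11.inv_b, map_add, map_mul,
    map_neg, Complex.conj_conj]
  have hdet := y.g.mul_conj_sub
  set u := z₁ y.g y.α z w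
  set v := w₁ y.g w
  have hG : gam x.α u v = u + x.α - conj x.α * v := rfl
  set Γ := gam x.α u v
  have hδ : delta y.g w = conj y.g.b * w + conj y.g.a := rfl
  have hδ1 : delta x.g v = conj x.g.b * v + conj x.g.a := rfl
  set δ := delta y.g w
  set δ1 := delta x.g v
  -- The old variables z, ā, b are eliminated in favour of the transformed point (u, v) and of δ,
  -- leaving an identity that follows from `hrel`.
  have hz : z = u * δ - y.α + conj y.α * w := by rw [e', gam]; ring
  have hA : conj y.g.a = δ - conj y.g.b * w := by rw [hδ]; ring
  have hb : y.g.b = v * δ - y.g.a * w := by rw [e]; ring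
  have hA1 : conj x.g.a = δ1 - conj x.g.b * v := by rw [hδ1]; ring
  -- The second factor is the denominator of the inverse of `y.g` at v: the denominators of an
  -- element and of its inverse are reciprocal.
  have hrel : δ * (y.g.a - conj y.g.b * v) = 1 := by
    linear_combination hdet - y.g.a * hA + conj y.g.b * hb
  have h1 : (conj x.g.a * conj y.g.b + conj x.g.b * y.g.a) * (Γ * δ) ^ 2 / (δ1 * δ) =
      conj y.g.b * δ * Γ ^ 2 + conj x.g.b * Γ ^ 2 / δ1 := by
    field_simp
    linear_combination Γ ^ 2 * (conj y.g.b * δ * hA1 + conj x.g.b * hrel)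
  have h2 : conj y.g.b * (u * δ) ^ 2 / δ = conj y.g.b * u ^ 2 * δ := by field_simp
  rw [h1, h2, hA]
  -- The conjugate is made opaque so that substituting for `y.g.b` leaves it untouched.
  generalize conj y.g.b = B at *
  rw [hb, hz, hG]
  linear_combination (conj x.α * (2 * u + x.α - conj x.α * v)) * hrel

theorem mult_mul (n : ℕ) (μ : ℝ) (x y : JacobiGroup) {p : ℂ × ℂ} (hp : p ∈ disk) :
    mult n μ (x * y) p = mult n μ x (act y p) * mult n μ y p := by
  have h := lam₁_mul x y (z := p.1) hp
  have key : -(1 / 2) * (μ : ℂ) * lam₁ (x * y).g (x * y).α p.1 p.2 +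
      Complex.I * μ * ((x * y).t : ℝ) =
      (-(1 / 2) * μ * lam₁ x.g x.α (act y p).1 (act y p).2 + Complex.I * μ * x.t) +
      (-(1 / 2) * μ * lam₁ y.g y.α p.1 p.2 + Complex.I * μ * y.t) := by
    simp only [act, JacobiGroup.mul_t]
    push_cast
    linear_combination (-(1 / 2) * (μ : ℂ)) * h
  simp only [mult, lam]
  rw [mul_assoc, ← Complex.exp_add, key, Complex.exp_add, Complex.exp_add, Complex.exp_add,
    JacobiGroup.mul_g, delta_mul _ _ hp, mul_pow, mul_inv]
  simp only [act]
  ring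

/-! ### Transitivity, stabilizer of the origin and kernel of the action -/

/-- A section of the orbit map of the origin of the Siegel-Jacobi disk. -/
def lift (p : ℂ × ℂ) : JacobiGroup :=
  ⟨SU11.normalize 1 p.2, conj (SU11.normalize 1 p.2).a * p.1, 0⟩

theorem zero_mem_disk : (0 : ℂ × ℂ) ∈ disk := by simp [disk]

theorem act_zero (x : JacobiGroup) : act x 0 = (x.α / conj x.g.a, x.g.b / conj x.g.a) := by
  simp [act, z₁, w₁, gam, delta]

theorem SU11.conj_a_ne_zero (g : SU11) : conj g.a ≠ 0 := by
  have := delta_ne_zero g (w := 0) (by simp)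
  simpa [delta] using this

theorem act_lift {p : ℂ × ℂ} (hp : p ∈ disk) : act (lift p) 0 = p := by
  have hp' : ‖p.2‖ < ‖(1 : ℂ)‖ := by simpa [disk] using hp
  have h : (SU11.normalize 1 p.2).b = p.2 * conj (SU11.normalize 1 p.2).a := by
    simp only [SU11.normalize, dif_pos hp', map_div₀, map_one, Complex.conj_ofReal]
    ring
  have ha := (SU11.normalize 1 p.2).conj_a_ne_zero
  rw [act_zero]
  refine Prod.ext ?_ ?_
  · exact mul_div_cancel_left₀ _ ha
  · simp only [lift]
    rw [h]
    exact mul_div_cancel_right₀ _ ha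

theorem lift_zero : lift 0 = 1 := by
  ext <;> simp [lift, SU11.normalize]

theorem act_transitive {p q : ℂ × ℂ} (hp : p ∈ disk) (hq : q ∈ disk) :
    ∃ x : JacobiGroup, act x p = q := by
  refine ⟨lift q * (lift p)⁻¹, ?_⟩
  have h : act (lift p)⁻¹ p = 0 := by
    have h1 := act_mul (lift p)⁻¹ (lift p) zero_mem_disk
    rwa [inv_mul_cancel, act_one, act_lift hp, eq_comm] at h1
  rw [act_mul _ _ hp, h, act_lift hq]

/-- The stabilizer of the origin is the product of the rotations and of the centre. -/
theorem eq_of_act_zero {x : JacobiGroup} (h : act x 0 = 0) :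
    ∃ θ : ℝ, x = .ofSU (.rot θ) * .ofH 0 x.t := by
  have ha := x.g.conj_a_ne_zero
  rw [act_zero, Prod.mk_eq_zero, div_eq_zero_iff, div_eq_zero_iff] at h
  have hα : x.α = 0 := h.1.resolve_right ha
  have hb : x.g.b = 0 := h.2.resolve_right ha
  have hn := x.g.norm_sub
  rw [hb, norm_zero] at hn
  have hn1 : ‖x.g.a‖ = 1 := by
    have := norm_nonneg x.g.a
    nlinarith
  refine ⟨Complex.arg x.g.a, ?_⟩
  have := Complex.norm_mul_exp_arg_mul_I x.g.a
  rw [hn1, Complex.ofReal_one, one_mul] at this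
  ext <;> simp [JacobiGroup.ofSU, JacobiGroup.ofH, SU11.rot, SU11.lin, this, hα, hb]

theorem act_eq_self_iff (x : JacobiGroup) :
    (∀ p ∈ disk, act x p = p) ↔ ∃ t : ℝ, x = .ofH 0 t := by
  constructor
  · intro h
    have ha := x.g.conj_a_ne_zero
    have h0 := h 0 zero_mem_disk
    rw [act_zero, Prod.mk_eq_zero, div_eq_zero_iff, div_eq_zero_iff] at h0
    have hα : x.α = 0 := h0.1.resolve_right ha
    have hb : x.g.b = 0 := h0.2.resolve_right ha
    -- Fixing the origin leaves only a rotation and a central element; the rotation sends (1, 0) to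
    -- (1/ā, 0), so this second point forces a = 1.
    have h1 := congrArg Prod.fst (h (1, 0) (by simp [disk]))
    simp only [act, z₁, gam, delta, hα, hb] at h1
    have ha1 : x.g.a = 1 := by
      rw [div_eq_iff (by simpa using ha)] at h1
      simpa using congrArg conj h1.symm
    exact ⟨x.t, by ext <;> simp [JacobiGroup.ofH, hα, hb, ha1]⟩
  · rintro ⟨t, rfl⟩ p -
    simp [act, JacobiGroup.ofH, z₁, w₁, gam, delta]

/-! ### Continuity and holomorphy of the action and of its factor -/

theorem continuousOn_act :
    ContinuousOn (fun q : JacobiGroup × (ℂ × ℂ) => act q.1 q.2) (Set.univ ×ˢ disk) := by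
  have hc : Continuous fun x : JacobiGroup => (x.g.a, x.g.b, x.α, x.t) := continuous_induced_dom
  have ha : Continuous fun x : JacobiGroup => x.g.a := continuous_fst.comp hc
  have hb : Continuous fun x : JacobiGroup => x.g.b := (continuous_fst.comp continuous_snd).comp hc
  have hα : Continuous fun x : JacobiGroup => x.α :=
    (continuous_fst.comp (continuous_snd.comp continuous_snd)).comp hc
  have ha' := ha.comp (continuous_fst (X := JacobiGroup) (Y := ℂ × ℂ))
  have hb' := hb.comp (continuous_fst (X := JacobiGroup) (Y := ℂ × ℂ))
  have hα' := hα.comp (continuous_fst (X := JacobiGroup) (Y := ℂ × ℂ))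
  simp only [Function.comp_def] at ha' hb' hα'
  have hδ : Continuous fun q : JacobiGroup × (ℂ × ℂ) => delta q.1.g q.2.2 := by
    unfold delta
    fun_prop
  have h0 : ∀ q ∈ (Set.univ ×ˢ disk : Set (JacobiGroup × (ℂ × ℂ))), delta q.1.g q.2.2 ≠ 0 :=
    fun q hq => delta_ne_zero _ hq.2
  unfold act z₁ w₁ gam
  refine ContinuousOn.prodMk (ContinuousOn.div ?_ hδ.continuousOn h0)
    (ContinuousOn.div ?_ hδ.continuousOn h0)
  all_goals exact Continuous.continuousOn (by fun_prop)

theorem differentiableOn_inv_delta (g : SU11) :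
    DifferentiableOn ℂ (fun p : ℂ × ℂ => (delta g p.2)⁻¹) disk := by
  have hδ : DifferentiableOn ℂ (fun p : ℂ × ℂ => delta g p.2) disk := by
    unfold delta
    fun_prop
  exact hδ.inv fun p hp => delta_ne_zero g hp

theorem differentiableOn_act (x : JacobiGroup) : DifferentiableOn ℂ (act x) disk := by
  have hδ := differentiableOn_inv_delta x.g
  unfold act z₁ w₁ gam
  simp only [div_eq_mul_inv]
  exact DifferentiableOn.prodMk (DifferentiableOn.mul (by fun_prop) hδ)
    (DifferentiableOn.mul (by fun_prop) hδ)

theorem differentiableOn_mult (n : ℕ) (μ : ℝ) (x : JacobiGroup) :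
    DifferentiableOn ℂ (mult n μ x) disk := by
  have hδ := differentiableOn_inv_delta x.g
  unfold mult lam lam₁
  simp only [div_eq_mul_inv _ (delta _ _), ← inv_pow]
  refine DifferentiableOn.mul_const (DifferentiableOn.mul (hδ.pow n) ?_) _
  refine DifferentiableOn.cexp (DifferentiableOn.const_mul ?_ _)
  unfold gam
  exact DifferentiableOn.add (by fun_prop) (DifferentiableOn.mul (by fun_prop) hδ)

theorem isOpen_disk : IsOpen disk :=
  isOpen_lt (continuous_norm.comp continuous_snd) continuous_const

/-! ### Smooth families of group elements -/

/-- The coordinates of an element of the Jacobi group. -/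
def JacobiGroup.coord (x : JacobiGroup) : ℂ × ℂ × ℂ × ℝ := (x.g.a, x.g.b, x.α, x.t)

/-- The retraction of the open set `|b| < |a|` onto the Jacobi group. -/
def JacobiGroup.ofCoord (p : ℂ × ℂ × ℂ × ℝ) : JacobiGroup :=
  ⟨SU11.normalize p.1 p.2.1, p.2.2.1, p.2.2.2⟩

/-- The domain of the retraction `JacobiGroup.ofCoord`. -/
def coordDomain : Set (ℂ × ℂ × ℂ × ℝ) := {p | ‖p.2.1‖ < ‖p.1‖}

theorem isOpen_coordDomain : IsOpen coordDomain :=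
  isOpen_lt (by fun_prop) (by fun_prop)

theorem SU11.norm_b_lt (g : SU11) : ‖g.b‖ < ‖g.a‖ := by
  have := g.norm_sub
  exact lt_of_pow_lt_pow_left₀ 2 (norm_nonneg _) (by linarith)

theorem SU11.normalize_self (g : SU11) : SU11.normalize g.a g.b = g := by
  ext <;> simp [SU11.normalize, g.norm_b_lt, g.norm_sub]

theorem JacobiGroup.coord_mem (x : JacobiGroup) : x.coord ∈ coordDomain := x.g.norm_b_lt

theorem JacobiGroup.ofCoord_coord (x : JacobiGroup) : ofCoord x.coord = x := by
  simp [ofCoord, coord, SU11.normalize_self]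

section Smooth

variable {V : Type*} [NormedAddCommGroup V] [NormedSpace ℝ V] {s : Set V}

theorem contDiffOn_conj {f : V → ℂ} (hf : ContDiffOn ℝ ∞ f s) :
    ContDiffOn ℝ ∞ (fun e => conj (f e)) s :=
  Complex.conjCLE.contDiff.comp_contDiffOn hf

theorem contDiffOn_ofReal {f : V → ℝ} (hf : ContDiffOn ℝ ∞ f s) :
    ContDiffOn ℝ ∞ (fun e => (f e : ℂ)) s :=
  Complex.ofRealCLM.contDiff.comp_contDiffOn hf

theorem contDiffOn_im {f : V → ℂ} (hf : ContDiffOn ℝ ∞ f s) :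
    ContDiffOn ℝ ∞ (fun e => (f e).im) s :=
  Complex.imCLM.contDiff.comp_contDiffOn hf

theorem contDiffOn_cexp {f : V → ℂ} (hf : ContDiffOn ℝ ∞ f s) :
    ContDiffOn ℝ ∞ (fun e => Complex.exp (f e)) s :=
  (Complex.contDiff_exp (𝕜 := ℝ)).comp_contDiffOn hf

/-- A family of elements of the Jacobi group is smooth if its coordinates are. -/
def SmoothFamilyOn (x : V → JacobiGroup) (s : Set V) : Prop :=
  ContDiffOn ℝ ∞ (fun e => (x e).coord) s

namespace SmoothFamilyOn

variable {x y : V → JacobiGroup}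

theorem a (h : SmoothFamilyOn x s) : ContDiffOn ℝ ∞ (fun e => (x e).g.a) s := h.fst

theorem b (h : SmoothFamilyOn x s) : ContDiffOn ℝ ∞ (fun e => (x e).g.b) s := h.snd.fst

theorem α (h : SmoothFamilyOn x s) : ContDiffOn ℝ ∞ (fun e => (x e).α) s := h.snd.snd.fst

theorem t (h : SmoothFamilyOn x s) : ContDiffOn ℝ ∞ (fun e => (x e).t) s := h.snd.snd.snd

theorem mk' (ha : ContDiffOn ℝ ∞ (fun e => (x e).g.a) s)
    (hb : ContDiffOn ℝ ∞ (fun e => (x e).g.b) s) (hα : ContDiffOn ℝ ∞ (fun e => (x e).α) s)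
    (ht : ContDiffOn ℝ ∞ (fun e => (x e).t) s) : SmoothFamilyOn x s :=
  ha.prodMk (hb.prodMk (hα.prodMk ht))

theorem mul (hx : SmoothFamilyOn x s) (hy : SmoothFamilyOn y s) :
    SmoothFamilyOn (fun e => x e * y e) s := by
  have hβ : ContDiffOn ℝ ∞ (fun e => (y e).g⁻¹.lin (x e).α) s :=
    ((contDiffOn_conj hy.a).mul hx.α).add (hy.b.neg.mul (contDiffOn_conj hx.α))
  exact mk' ((hx.a.mul hy.a).add (hx.b.mul (contDiffOn_conj hy.b)))
    ((hx.a.mul hy.b).add (hx.b.mul (contDiffOn_conj hy.a))) (hβ.add hy.α)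
    ((hx.t.add hy.t).add (contDiffOn_im (hβ.mul (contDiffOn_conj hy.α))))

theorem comp {W : Type*} [NormedAddCommGroup W] [NormedSpace ℝ W] {u : Set W} {f : W → V}
    (hx : SmoothFamilyOn x s) (hf : ContDiffOn ℝ ∞ f u) (h : Set.MapsTo f u s) :
    SmoothFamilyOn (fun e => x (f e)) u :=
  ContDiffOn.comp hx hf h

end SmoothFamilyOn

theorem contDiffOn_normalize {f g : V → ℂ} (hf : ContDiffOn ℝ ∞ f s) (hg : ContDiffOn ℝ ∞ g s)
    (h : ∀ e ∈ s, ‖g e‖ < ‖f e‖) :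
    ContDiffOn ℝ ∞ (fun e => (SU11.normalize (f e) (g e)).a) s ∧
      ContDiffOn ℝ ∞ (fun e => (SU11.normalize (f e) (g e)).b) s := by
  have hp : ∀ e ∈ s, ‖f e‖ ^ 2 - ‖g e‖ ^ 2 ≠ 0 := fun e he => by
    have := h e he
    have := norm_nonneg (g e)
    nlinarith
  have hr : ContDiffOn ℝ ∞ (fun e => ((Real.sqrt (‖f e‖ ^ 2 - ‖g e‖ ^ 2) : ℝ) : ℂ)) s :=
    contDiffOn_ofReal (((hf.norm_sq ℝ).sub (hg.norm_sq ℝ)).sqrt hp)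
  have hr0 : ∀ e ∈ s, ((Real.sqrt (‖f e‖ ^ 2 - ‖g e‖ ^ 2) : ℝ) : ℂ) ≠ 0 := fun e he => by
    have := h e he
    have := norm_nonneg (g e)
    exact_mod_cast (Real.sqrt_pos.2 (by nlinarith)).ne'
  constructor
  · refine (hf.mul (hr.inv hr0)).congr fun e he => ?_
    simp [SU11.normalize, h e he, div_eq_mul_inv]
  · refine (hg.mul (hr.inv hr0)).congr fun e he => ?_
    simp [SU11.normalize, h e he, div_eq_mul_inv]

theorem smoothFamilyOn_ofCoord : SmoothFamilyOn JacobiGroup.ofCoord coordDomain := by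
  have h := contDiffOn_normalize (s := coordDomain) (f := fun p => p.1) (g := fun p => p.2.1)
    contDiff_fst.contDiffOn (contDiff_fst.comp contDiff_snd).contDiffOn fun e he => he
  exact .mk' h.1 h.2 (contDiff_fst.comp (contDiff_snd.comp contDiff_snd)).contDiffOn
    (contDiff_snd.comp (contDiff_snd.comp contDiff_snd)).contDiffOn

theorem smoothFamilyOn_lift : SmoothFamilyOn lift disk := by
  have h := contDiffOn_normalize (s := disk) (f := fun _ => 1) (g := fun p => p.2)
    contDiffOn_const contDiff_snd.contDiffOn fun e he => by simpa [disk] using he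
  exact .mk' h.1 h.2 ((contDiffOn_conj h.1).mul contDiff_fst.contDiffOn) contDiffOn_const

theorem contDiffOn_mult_zero (n : ℕ) (μ : ℝ) {x : V → JacobiGroup} (hx : SmoothFamilyOn x s) :
    ContDiffOn ℝ ∞ (fun e => (mult n μ (x e) 0)⁻¹) s := by
  have hA := contDiffOn_conj hx.a
  have hB := contDiffOn_conj hx.b
  have hα := contDiffOn_conj hx.α
  have h0 : ∀ e ∈ s, conj (x e).g.a ≠ 0 := fun e _ => (x e).g.conj_a_ne_zero
  refine ContDiffOn.inv ?_ fun e _ => mult_ne_zero n μ (x e) zero_mem_disk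
  simp only [mult, lam, lam₁, delta, gam, Prod.fst_zero, Prod.snd_zero, mul_zero, zero_add,
    sub_zero, div_eq_mul_inv _ (conj (SU11.a _))]
  refine ContDiffOn.mul (ContDiffOn.mul ((hA.pow n).inv fun e he => pow_ne_zero _ (h0 e he)) ?_) ?_
  · exact contDiffOn_cexp (contDiffOn_const.mul ((hα.mul hx.α).add
      ((hB.mul (hx.α.pow 2)).mul (hA.inv h0))))
  · exact contDiffOn_cexp (contDiffOn_const.mul (contDiffOn_ofReal hx.t))

theorem smoothFamilyOn_hyp : SmoothFamilyOn (fun t => .ofSU (.hyp t)) Set.univ :=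
  .mk' (contDiffOn_ofReal Real.contDiff_cosh.contDiffOn)
    (contDiffOn_ofReal Real.contDiff_sinh.contDiffOn) contDiffOn_const contDiffOn_const

theorem smoothFamilyOn_hyp' : SmoothFamilyOn (fun t => .ofSU (.hyp' t)) Set.univ :=
  .mk' (contDiffOn_ofReal Real.contDiff_cosh.contDiffOn)
    (contDiffOn_const.mul (contDiffOn_ofReal Real.contDiff_sinh.contDiffOn))
    contDiffOn_const contDiffOn_const

theorem smoothFamilyOn_rot : SmoothFamilyOn (fun t => .ofSU (.rot t)) Set.univ :=
  .mk' (contDiffOn_cexp ((contDiffOn_ofReal contDiffOn_id).mul contDiffOn_const))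
    contDiffOn_const contDiffOn_const contDiffOn_const

theorem smoothFamilyOn_ofH {f : V → ℂ} (hf : ContDiffOn ℝ ∞ f s) :
    SmoothFamilyOn (fun e => .ofH (f e) 0) s :=
  .mk' contDiffOn_const contDiffOn_const hf contDiffOn_const

theorem smoothFamilyOn_ofH_real : SmoothFamilyOn (fun t : ℝ => .ofH t 0) Set.univ :=
  smoothFamilyOn_ofH (contDiffOn_ofReal contDiffOn_id)

theorem smoothFamilyOn_ofH_imag :
    SmoothFamilyOn (fun t : ℝ => .ofH (Complex.I * t) 0) Set.univ :=
  smoothFamilyOn_ofH (contDiffOn_const.mul (contDiffOn_ofReal contDiffOn_id))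

/-- The partial derivative in the real direction at `t = 0` of a smooth family is smooth. -/
theorem contDiffOn_deriv_zero {F : Type*} [NormedAddCommGroup F] [NormedSpace ℝ F] 
    {Φ : V × ℝ → F} (hs : IsOpen s)
    (hΦ : ContDiffOn ℝ ∞ Φ (s ×ˢ Set.univ)) :
    ContDiffOn ℝ ∞ (fun e => deriv (fun t => Φ (e, t)) 0) s := by
  have ho : IsOpen (s ×ˢ (Set.univ : Set ℝ)) := hs.prod isOpen_univ
  have h1 : ContDiffOn ℝ ∞ (fun e => fderiv ℝ Φ (e, 0) (0, 1)) s := by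
    have := (hΦ.fderiv_of_isOpen (m := ∞) ho (by simp)).comp (f := fun e : V => (e, (0 : ℝ)))
      (contDiff_id.prodMk contDiff_const).contDiffOn fun e he => ⟨he, trivial⟩
    exact this.clm_apply contDiffOn_const
  refine h1.congr fun e he => ?_
  have hd : HasFDerivAt Φ (fderiv ℝ Φ (e, 0)) (e, 0) :=
    ((hΦ.differentiableOn (by simp)).differentiableAt (ho.mem_nhds ⟨he, trivial⟩)).hasFDerivAt
  have hc : HasDerivAt (fun t : ℝ => (e, t)) ((0 : V), (1 : ℝ)) 0 :=
    (hasDerivAt_const _ _).prodMk (hasDerivAt_id _)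
  exact (hd.comp_hasDerivAt (0 : ℝ) hc).deriv

/-! ### Smooth vectors and the derived representation -/

variable {H : Type*} [NormedAddCommGroup H] [InnerProductSpace ℂ H] [CompleteSpace H]
  {π : JacobiGroup →* unitary (H →L[ℂ] H)} {v u : H}

/-- The retraction fixes the group pointwise, so the orbit map along a family is the ambient test
function composed with the coordinates of the family. -/
theorem IsSmoothVector.contDiffOn_orbit (hv : IsSmoothVector π v) {x : V → JacobiGroup}
    (hx : SmoothFamilyOn x s) : ContDiffOn ℝ ∞ (fun e => (π (x e) : H →L[ℂ] H) v) s := by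
  refine (ContDiffOn.comp (f := fun e => (x e).coord) hv hx
    fun e _ => (x e).coord_mem).congr fun e _ => ?_
  exact congrArg (fun y => (π y : H →L[ℂ] H) v) (x e).ofCoord_coord.symm

theorem IsSmoothVector.add (hv : IsSmoothVector π v) (hu : IsSmoothVector π u) :
    IsSmoothVector π (v + u) := by
  unfold IsSmoothVector
  simp only [map_add]
  exact ContDiffOn.add hv hu

theorem IsSmoothVector.smul (c : ℂ) (hv : IsSmoothVector π v) : IsSmoothVector π (c • v) := by
  unfold IsSmoothVector
  simp only [map_smul]
  exact contDiffOn_const.smul hv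

theorem IsSmoothVector.sub (hv : IsSmoothVector π v) (hu : IsSmoothVector π u) :
    IsSmoothVector π (v - u) := by
  unfold IsSmoothVector
  simp only [map_sub]
  exact ContDiffOn.sub hv hu

theorem IsSmoothVector.hasDerivAt (hv : IsSmoothVector π v) {γ : ℝ → JacobiGroup}
    (hγ : SmoothFamilyOn γ Set.univ) :
    HasDerivAt (fun t => (π (γ t) : H →L[ℂ] H) v) (dpi π γ v) 0 := by
  have h := contDiffOn_univ.1 (hv.contDiffOn_orbit hγ)
  exact (h.differentiable (by simp) 0).hasDerivAt

/-- Applying π(x) to the derived vector gives the t-derivative at 0 of π(x γ(t)) v, which is jointly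
smooth in x and t. This keeps all iterates of the raising operator on `e₀` smooth. -/
theorem IsSmoothVector.dpi (hv : IsSmoothVector π v) {γ : ℝ → JacobiGroup}
    (hγ : SmoothFamilyOn γ Set.univ) : IsSmoothVector π (dpi π γ v) := by
  have hΦ : SmoothFamilyOn (fun q : (ℂ × ℂ × ℂ × ℝ) × ℝ => JacobiGroup.ofCoord q.1 * γ q.2)
      (coordDomain ×ˢ Set.univ) :=
    (smoothFamilyOn_ofCoord.comp contDiff_fst.contDiffOn fun q hq => hq.1).mul
      (hγ.comp contDiff_snd.contDiffOn fun q _ => trivial)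
  refine (contDiffOn_deriv_zero isOpen_coordDomain (hv.contDiffOn_orbit hΦ)).congr fun p _ => ?_
  have h := ((π (JacobiGroup.ofCoord p) : H →L[ℂ] H).restrictScalars ℝ).hasFDerivAt.comp_hasDerivAt
    (0 : ℝ) (hv.hasDerivAt hγ)
  refine Eq.trans ?_ h.deriv.symm |>.trans ?_
  · rfl
  · refine congrArg (fun f => deriv f 0) (funext fun t => ?_)
    simp [map_mul]

theorem IsSmoothVector.creation (μ : ℝ) (hv : IsSmoothVector π v) :
    IsSmoothVector π (creation μ π v) :=
  ((hv.dpi smoothFamilyOn_ofH_real).sub ((hv.dpi smoothFamilyOn_ofH_imag).smul _)).smul _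

theorem IsSmoothVector.Kplus (hv : IsSmoothVector π v) : IsSmoothVector π (Kplus π v) :=
  ((hv.dpi smoothFamilyOn_hyp).sub ((hv.dpi smoothFamilyOn_hyp').smul _)).smul _

/-- The operator `√μ z a† + w K₊`. -/
def raising (μ : ℝ) (π : JacobiGroup →* unitary (H →L[ℂ] H)) (z w : ℂ) (v : H) : H :=
  ((Real.sqrt μ : ℂ) * z) • SiegelJacobi.creation μ π v + w • SiegelJacobi.Kplus π v

theorem IsSmoothVector.coherentTerm (μ : ℝ) (hv : IsSmoothVector π v) (z w : ℂ) (j : ℕ) :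
    IsSmoothVector π (coherentTerm μ π v z w j) := by
  refine IsSmoothVector.smul _ ?_
  induction j with
  | zero => exact hv
  | succ j ih =>
    rw [Function.iterate_succ_apply']
    exact ((ih.creation μ).smul _).add (ih.Kplus.smul _)

/-- The derivative at 0 of α ↦ D(α)v is a real-linear map; √μ a† and -√μ a give its complex-linear
and antilinear parts. -/
theorem IsSmoothVector.hasDerivAt_D {μ : ℝ} (hμ : 0 < μ) (hv : IsSmoothVector π v) (α : ℂ) :
    HasDerivAt (fun s : ℝ => D π (s * α) v)
      ((Real.sqrt μ : ℂ) • (α • SiegelJacobi.creation μ π v - conj α • annihilation μ π v)) 0 := by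
  have hf : ContDiff ℝ ∞ (fun z : ℂ => (π (.ofH z 0) : H →L[ℂ] H) v) :=
    contDiffOn_univ.1 (hv.contDiffOn_orbit (smoothFamilyOn_ofH contDiffOn_id))
  have hL := (hf.differentiable (by simp) 0).hasFDerivAt
  set L := fderiv ℝ (fun z : ℂ => (π (.ofH z 0) : H →L[ℂ] H) v) 0
  have hline : ∀ β : ℂ, HasDerivAt (fun s : ℝ => (π (.ofH (s * β) 0) : H →L[ℂ] H) v) (L β) 0 := by
    intro β
    have h1 : HasDerivAt (fun s : ℝ => (s : ℂ) * β) β 0 := by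
      simpa using (Complex.ofRealCLM.hasDerivAt (x := (0 : ℝ))).mul_const β
    have hL' : HasFDerivAt (fun z : ℂ => (π (.ofH z 0) : H →L[ℂ] H) v) L (((0 : ℝ) : ℂ) * β) := by
      simpa using hL
    exact hL'.comp_hasDerivAt (0 : ℝ) h1
  have hr : SiegelJacobi.dpi π (fun t => .ofH t 0) v = L 1 := by
    rw [SiegelJacobi.dpi]
    simpa using (hline 1).deriv
  have hi : SiegelJacobi.dpi π (fun t => .ofH (Complex.I * t) 0) v = L Complex.I := by
    rw [SiegelJacobi.dpi]
    simpa [mul_comm] using (hline Complex.I).deriv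
  have hs : (Real.sqrt μ : ℂ) ≠ 0 := by exact_mod_cast (Real.sqrt_pos.2 hμ).ne'
  have hα : L α = (α.re : ℂ) • L 1 + (α.im : ℂ) • L Complex.I := by
    conv_lhs => rw [← Complex.re_add_im α]
    rw [map_add, Complex.coe_smul, Complex.coe_smul, ← map_smul, ← map_smul]
    simp
  refine HasDerivAt.congr_deriv (hline α) ?_
  rw [hα, SiegelJacobi.creation, annihilation, hr, hi, Complex.re_eq_add_conj,
    Complex.im_eq_sub_conj]
  push_cast
  match_scalars
  · field_simp
    ring
  · field_simp
    ring_nf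
    simp [Complex.I_sq]
    ring

end Smooth

/-! ### Infinitesimal action and infinitesimal factor along one-parameter subgroups -/

section CurveDerivatives

variable (n : ℕ) (μ : ℝ)

theorem hasDerivAt_conj {f : ℝ → ℂ} {f' : ℂ} {t : ℝ} (hf : HasDerivAt f f' t) :
    HasDerivAt (fun s => conj (f s)) (conj f') t :=
  Complex.conjCLE.hasFDerivAt.comp_hasDerivAt t hf

theorem hasDerivAt_delta {g : ℝ → SU11} {a' b' : ℂ}
    (ha : HasDerivAt (fun t => (g t).a) a' 0) (hb : HasDerivAt (fun t => (g t).b) b' 0) (w : ℂ) :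
    HasDerivAt (fun t => delta (g t) w) (conj b' * w + conj a') 0 :=
  ((hasDerivAt_conj hb).mul_const w).add (hasDerivAt_conj ha)

theorem hasDerivAt_mult_ofSU {g : ℝ → SU11} {a' b' : ℂ} (h1 : g 0 = 1)
    (ha : HasDerivAt (fun t => (g t).a) a' 0) (hb : HasDerivAt (fun t => (g t).b) b' 0)
    (p : ℂ × ℂ) :
    HasDerivAt (fun t => mult n μ (.ofSU (g t)) p)
      (-n * (conj b' * p.2 + conj a') - 1 / 2 * μ * conj b' * p.1 ^ 2) 0 := by
  have hδ := hasDerivAt_delta ha hb p.2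
  have hδ1 : delta 1 p.2 = 1 := by simp [delta]
  have hq := ((hasDerivAt_conj hb).mul_const (p.1 ^ 2)).mul (hδ.inv (by simp [h1, hδ1]))
  have he := (hq.const_mul (-(1 / 2) * (μ : ℂ))).cexp
  refine ((((hδ.pow n).inv (by simp [h1, hδ1])).mul he).congr_deriv ?_).congr_of_eventuallyEq
    (.of_forall fun t => ?_)
  · simp [hδ1, h1]
    ring
  · simp [mult, lam, lam₁, JacobiGroup.ofSU, gam, div_eq_mul_inv]

theorem hasDerivAt_act_ofSU {g : ℝ → SU11} {a' b' : ℂ} (h1 : g 0 = 1)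
    (ha : HasDerivAt (fun t => (g t).a) a' 0) (hb : HasDerivAt (fun t => (g t).b) b' 0)
    (p : ℂ × ℂ) :
    HasDerivAt (fun t => act (.ofSU (g t)) p)
      (-(p.1 * (conj b' * p.2 + conj a')),
        a' * p.2 + b' - p.2 * (conj b' * p.2 + conj a')) 0 := by
  have hδ := hasDerivAt_delta ha hb p.2
  have hδ1 : delta 1 p.2 = 1 := by simp [delta]
  have hi := hδ.inv (by simp [h1, hδ1])
  refine (((hi.const_mul p.1).prodMk (((ha.mul_const p.2).add hb).mul hi)).congr_deriv
    ?_).congr_of_eventuallyEq (.of_forall fun t => ?_)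
  · ext
    · simp [hδ1, h1]
      ring
    · simp [hδ1, h1]
      ring
  · simp [act, z₁, w₁, JacobiGroup.ofSU, gam, div_eq_mul_inv]

theorem hyp_zero : SU11.hyp 0 = 1 := by
  ext <;> simp [SU11.hyp]

theorem hyp'_zero : SU11.hyp' 0 = 1 := by
  ext <;> simp [SU11.hyp']

theorem hasDerivAt_hyp_a : HasDerivAt (fun t => (SU11.hyp t).a) 0 0 := by
  refine (Real.hasDerivAt_cosh 0).ofReal_comp.congr_deriv ?_
  simp

theorem hasDerivAt_hyp_b : HasDerivAt (fun t => (SU11.hyp t).b) 1 0 := by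
  refine (Real.hasDerivAt_sinh 0).ofReal_comp.congr_deriv ?_
  simp

theorem hasDerivAt_hyp'_a : HasDerivAt (fun t => (SU11.hyp' t).a) 0 0 := hasDerivAt_hyp_a

theorem hasDerivAt_hyp'_b : HasDerivAt (fun t => (SU11.hyp' t).b) Complex.I 0 := by
  refine (hasDerivAt_hyp_b.const_mul Complex.I).congr_deriv ?_
  simp

theorem hasDerivAt_mult_ofH (β : ℂ) (p : ℂ × ℂ) :
    HasDerivAt (fun t : ℝ => mult n μ (.ofH (β * t) 0) p) (-(μ * conj β * p.1)) 0 := by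
  have h : ∀ c : ℂ, HasDerivAt (fun t : ℝ => c * (t : ℂ)) c 0 := fun c => by
    simpa using (Complex.ofRealCLM.hasDerivAt (x := (0 : ℝ))).const_mul c
  have hq := (h (conj β)).mul (((((h β).const_add p.1).sub ((h (conj β)).mul_const p.2))).const_add
    p.1)
  refine (((hq.const_mul (-(1 / 2) * (μ : ℂ))).cexp).congr_deriv ?_).congr_of_eventuallyEq
    (.of_forall fun t => ?_)
  · simp
    ring
  · simp [mult, lam, lam₁, delta, JacobiGroup.ofH, gam]

theorem hasDerivAt_act_ofH (β : ℂ) (p : ℂ × ℂ) :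
    HasDerivAt (fun t : ℝ => act (.ofH (β * t) 0) p) (β - conj β * p.2, 0) 0 := by
  have h : ∀ c : ℂ, HasDerivAt (fun t : ℝ => c * (t : ℂ)) c 0 := fun c => by
    simpa using (Complex.ofRealCLM.hasDerivAt (x := (0 : ℝ))).const_mul c
  have := (((h β).const_add p.1).sub ((h (conj β)).mul_const p.2)).prodMk
    (hasDerivAt_const (0 : ℝ) p.2)
  refine this.congr_of_eventuallyEq (.of_forall fun t => ?_)
  simp [act, z₁, w₁, gam, delta, JacobiGroup.ofH]

end CurveDerivatives

/-! ### The equivariant holomorphic family through `e₀` -/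

theorem rot_add (s t : ℝ) : SU11.rot (s + t) = SU11.rot s * SU11.rot t := by
  ext <;> simp [SU11.rot, add_mul, Complex.exp_add]

theorem ofSU_mul (g h : SU11) :
    JacobiGroup.ofSU (g * h) = JacobiGroup.ofSU g * JacobiGroup.ofSU h := by
  ext <;> simp [JacobiGroup.ofSU, SU11.lin]

theorem rot_zero : SU11.rot 0 = 1 := by
  ext <;> simp [SU11.rot]

theorem eq_smul_of_map_I {F : Type*} [NormedAddCommGroup F] [NormedSpace ℂ F] (L : ℂ →L[ℝ] F)
    (hL : L Complex.I = Complex.I • L 1) (q : ℂ) :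
    L q = q • L 1 := by
  conv_lhs => rw [← Complex.re_add_im q, ← mul_one (q.re : ℂ), ← Complex.real_smul,
    ← Complex.real_smul, map_add, map_smul, map_smul, hL, ← Complex.coe_smul, ← Complex.coe_smul,
    smul_smul, ← add_smul, Complex.re_add_im]

section Representation

variable {H : Type*} [NormedAddCommGroup H] [InnerProductSpace ℂ H] [CompleteSpace H]
  {π : JacobiGroup →* unitary (H →L[ℂ] H)} {e₀ : H} {k μ : ℝ} {n : ℕ}

theorem map_mul_apply (π : JacobiGroup →* unitary (H →L[ℂ] H)) (x y : JacobiGroup) (v : H) :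
    (π (x * y) : H →L[ℂ] H) v = (π x : H →L[ℂ] H) ((π y : H →L[ℂ] H) v) := by
  simp [map_mul]

theorem smul_creation (hμ : 0 < μ) (v : H) :
    (Real.sqrt μ : ℂ) • creation μ π v = (1 / 2 : ℂ) • (dpi π (fun t => .ofH t 0) v -
      Complex.I • dpi π (fun t => .ofH (Complex.I * t) 0) v) := by
  have hs : (Real.sqrt μ : ℂ) ≠ 0 := by exact_mod_cast (Real.sqrt_pos.2 hμ).ne'
  rw [creation, smul_smul]
  congr 1
  push_cast
  field_simp

namespace IsExtremalWeight

theorem dpi_rot (h : IsExtremalWeight k μ π e₀) (hk : 2 * k = n) :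
    dpi π (fun t => .ofSU (.rot t)) e₀ = (Complex.I * n) • e₀ := by
  have h0 := h.K₀_eq
  have hk' : (n : ℂ) = 2 * k := by exact_mod_cast hk.symm
  rw [K₀] at h0
  have h1 := congrArg (fun v => (2 * Complex.I) • v) h0
  simp only [smul_smul] at h1
  rw [show 2 * Complex.I * (-Complex.I / 2) = 1 by ring_nf; simp, one_smul] at h1
  rw [h1, hk']
  congr 1
  ring

theorem rot_apply (h : IsExtremalWeight k μ π e₀) (hk : 2 * k = n) (θ : ℝ) :
    (π (.ofSU (.rot θ)) : H →L[ℂ] H) e₀ = Complex.exp (Complex.I * n * θ) • e₀ := by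
  have hd : ∀ θ : ℝ, HasDerivAt (fun θ : ℝ => (π (.ofSU (.rot θ)) : H →L[ℂ] H) e₀)
      ((Complex.I * n) • (π (.ofSU (.rot θ)) : H →L[ℂ] H) e₀) θ := by
    intro θ
    have h1 := h.smooth.hasDerivAt smoothFamilyOn_rot
    rw [h.dpi_rot hk] at h1
    have h2 := ((π (.ofSU (.rot θ)) : H →L[ℂ] H).restrictScalars ℝ).hasFDerivAt.comp_hasDerivAt
      (0 : ℝ) h1
    -- The base point 0 is written θ - θ so that `comp_sub_const` can translate the derivative to θ.
    have h3 : HasDerivAt (fun t : ℝ => (π (.ofSU (.rot (θ + t))) : H →L[ℂ] H) e₀)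
        ((Complex.I * n) • (π (.ofSU (.rot θ)) : H →L[ℂ] H) e₀) (θ - θ) := by
      rw [sub_self, ← map_smul]
      refine h2.congr_of_eventuallyEq (.of_forall fun t => ?_)
      simp only [rot_add, ofSU_mul, map_mul_apply]
      rfl
    have h4 := h3.comp_sub_const θ θ
    refine h4.congr_of_eventuallyEq (.of_forall fun t => ?_)
    simp
  -- Integrating factor: the orbit solves u' = i n u, so e^{-inθ} u is constant.
  have hz : ∀ θ : ℝ, HasDerivAt (fun θ : ℝ => Complex.exp (-(Complex.I * n) * θ) •
      (π (.ofSU (.rot θ)) : H →L[ℂ] H) e₀) 0 θ := by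
    intro θ
    have h1 : HasDerivAt (fun θ : ℝ => -(Complex.I * n) * (θ : ℂ)) (-(Complex.I * n)) θ := by
      simpa using (Complex.ofRealCLM.hasDerivAt (x := θ)).const_mul (-(Complex.I * n))
    refine (h1.cexp.smul (hd θ)).congr_deriv ?_
    module
  have hc := is_const_of_deriv_eq_zero (fun θ => (hz θ).differentiableAt)
    (fun θ => (hz θ).deriv) θ 0
  have h1 : JacobiGroup.ofSU 1 = 1 := rfl
  simp only [rot_zero, h1, map_one, Complex.ofReal_zero, mul_zero, Complex.exp_zero, one_smul,
    OneMemClass.coe_one, one_apply_eq_self] at hc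
  conv_rhs => rw [← hc]
  rw [smul_smul, ← Complex.exp_add]
  simp

/-- For a rotation δ = e^{-iθ} at the origin, so δ^{-n} is the eigenvalue e^{inθ}; the centre
contributes e^{iμt}. This agreement makes `orbitFamily` independent of the chosen section. -/
theorem stabilizer_apply (h : IsExtremalWeight k μ π e₀) (hk : 2 * k = n) {x : JacobiGroup}
    (hx : act x 0 = 0) : (π x : H →L[ℂ] H) e₀ = mult n μ x 0 • e₀ := by
  obtain ⟨θ, hθ⟩ := eq_of_act_zero hx
  rw [hθ, map_mul_apply, h.central, map_smul, h.rot_apply hk, smul_smul, mult_mul _ _ _ _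
    zero_mem_disk, mul_comm]
  have h1 : act (JacobiGroup.ofH 0 x.t) 0 = 0 := by
    simp [act_zero, JacobiGroup.ofH]
  rw [h1]
  congr 2
  · simp only [mult, lam, delta, lam₁, gam, JacobiGroup.ofSU, SU11.rot]
    simp [← Complex.exp_conj, ← Complex.exp_nat_mul, ← Complex.exp_neg]
    ring_nf
  · simp [mult, lam, delta, lam₁, gam, JacobiGroup.ofH]

end IsExtremalWeight

/-- The holomorphic family of vectors on the Siegel-Jacobi disk obtained by transporting `e₀`. -/
def orbitFamily (n : ℕ) (μ : ℝ) (π : JacobiGroup →* unitary (H →L[ℂ] H)) (e₀ : H) (p : ℂ × ℂ) :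
    H :=
  (mult n μ (lift p) 0)⁻¹ • (π (lift p) : H →L[ℂ] H) e₀

theorem orbitFamily_zero : orbitFamily n μ π e₀ 0 = e₀ := by
  simp [orbitFamily, lift_zero, mult_one]

namespace IsExtremalWeight

/-- Both x · lift p and lift (x · p) carry the origin to the same point, so they differ by an
element u of the stabilizer; the cocycle identity collects the scalars. -/
theorem apply_orbitFamily (h : IsExtremalWeight k μ π e₀) (hk : 2 * k = n) (x : JacobiGroup)
    {p : ℂ × ℂ} (hp : p ∈ disk) :
    (π x : H →L[ℂ] H) (orbitFamily n μ π e₀ p) =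
      mult n μ x p • orbitFamily n μ π e₀ (act x p) := by
  have hq := act_mem_disk x hp
  set y := lift (act x p) with hy
  have hy0 : act y 0 = act x p := act_lift hq
  obtain ⟨u, hu⟩ : ∃ u, x * lift p = y * u := ⟨y⁻¹ * (x * lift p), by group⟩
  have hu0 : act u 0 = 0 := by
    have h1 : act (y * u) 0 = act y 0 := by
      rw [← hu, act_mul _ _ zero_mem_disk, act_lift hp, hy0]
    have h2 := congrArg (act y⁻¹) h1
    rwa [← act_mul _ _ zero_mem_disk, ← act_mul _ _ zero_mem_disk, inv_mul_cancel_left,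
      inv_mul_cancel, act_one] at h2
  have hm : mult n μ x p * mult n μ (lift p) 0 = mult n μ y 0 * mult n μ u 0 := by
    have h1 := mult_mul n μ x (lift p) zero_mem_disk
    rw [act_lift hp] at h1
    rw [← h1, hu, mult_mul n μ y u zero_mem_disk, hu0]
  have hl := mult_ne_zero n μ (lift p) zero_mem_disk
  have hy1 := mult_ne_zero n μ y zero_mem_disk
  rw [orbitFamily, orbitFamily, map_smul, ← map_mul_apply, hu, map_mul_apply,
    h.stabilizer_apply hk hu0, map_smul, smul_smul, smul_smul, ← hy]
  congr 1
  field_simp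
  linear_combination -hm

/-- Operators π(x) need not vary smoothly in norm; joint smoothness comes from moving x inside the
orbit map, π(x) π(lift p) e₀ = π(x · lift p) e₀. -/
theorem contDiffOn_apply_orbitFamily (h : IsExtremalWeight k μ π e₀) {V : Type*}
    [NormedAddCommGroup V] [NormedSpace ℝ V] {s : Set V} {x : V → JacobiGroup}
    (hx : SmoothFamilyOn x s) {f : V → ℂ × ℂ} (hf : ContDiffOn ℝ ∞ f s)
    (hfs : Set.MapsTo f s disk) :
    ContDiffOn ℝ ∞ (fun e => (π (x e) : H →L[ℂ] H) (orbitFamily n μ π e₀ (f e))) s := by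
  have hl := smoothFamilyOn_lift.comp hf hfs
  refine ((contDiffOn_mult_zero n μ hl).smul (h.smooth.contDiffOn_orbit (hx.mul hl))).congr
    fun e _ => ?_
  rw [orbitFamily, map_smul]
  exact congrArg _ (map_mul_apply π _ _ _).symm

theorem contDiffOn_orbitFamily (h : IsExtremalWeight k μ π e₀) :
    ContDiffOn ℝ ∞ (orbitFamily n μ π e₀) disk :=
  (contDiffOn_mult_zero n μ smoothFamilyOn_lift).smul
    (h.smooth.contDiffOn_orbit smoothFamilyOn_lift)

/-- Product and chain rules applied to the equivariance: m is the infinitesimal multiplier and ξ the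
vector field of the action. Only real differentiability is used, since holomorphy is deduced from
this formula. -/
theorem dpi_orbitFamily (h : IsExtremalWeight k μ π e₀) (hk : 2 * k = n) {p : ℂ × ℂ}
    (hp : p ∈ disk) {γ : ℝ → JacobiGroup} (hγ : γ 0 = 1) {m : ℂ} {ξ : ℂ × ℂ}
    (hm : HasDerivAt (fun t => mult n μ (γ t) p) m 0)
    (hξ : HasDerivAt (fun t => act (γ t) p) ξ 0) :
    dpi π γ (orbitFamily n μ π e₀ p) =
      m • orbitFamily n μ π e₀ p + fderiv ℝ (orbitFamily n μ π e₀) p ξ := by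
  have hE : HasFDerivAt (orbitFamily n μ π e₀) (fderiv ℝ (orbitFamily n μ π e₀) p)
      (act (γ 0) p) := by
    rw [hγ, act_one]
    exact ((h.contDiffOn_orbitFamily.differentiableOn (by simp)).differentiableAt
      (isOpen_disk.mem_nhds hp)).hasFDerivAt
  have := (hm.smul (hE.comp_hasDerivAt (0 : ℝ) hξ)).deriv
  simp only [Function.comp_def, hγ, act_one, mult_one, one_smul] at this
  rw [dpi, add_comm, ← this]
  exact congrArg (fun f => deriv f 0) (funext fun t => h.apply_orbitFamily hk (γ t) hp)

theorem dpi_hyp_orbitFamily (h : IsExtremalWeight k μ π e₀) (hk : 2 * k = n) {p : ℂ × ℂ}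
    (hp : p ∈ disk) :
    dpi π (fun t => .ofSU (.hyp t)) (orbitFamily n μ π e₀ p) =
      (-n * p.2 - 1 / 2 * μ * p.1 ^ 2) • orbitFamily n μ π e₀ p +
        fderiv ℝ (orbitFamily n μ π e₀) p (-(p.1 * p.2), 1 - p.2 ^ 2) := by
  convert h.dpi_orbitFamily hk hp (γ := fun t => .ofSU (.hyp t)) (by rw [hyp_zero]; rfl)
    (hasDerivAt_mult_ofSU n μ hyp_zero hasDerivAt_hyp_a hasDerivAt_hyp_b p)
    (hasDerivAt_act_ofSU hyp_zero hasDerivAt_hyp_a hasDerivAt_hyp_b p) using 3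
  · simp
  · ext <;> simp [sq]

theorem dpi_hyp'_orbitFamily (h : IsExtremalWeight k μ π e₀) (hk : 2 * k = n) {p : ℂ × ℂ}
    (hp : p ∈ disk) :
    dpi π (fun t => .ofSU (.hyp' t)) (orbitFamily n μ π e₀ p) =
      (Complex.I * (n * p.2 + 1 / 2 * μ * p.1 ^ 2)) • orbitFamily n μ π e₀ p +
        fderiv ℝ (orbitFamily n μ π e₀) p
          (Complex.I * (p.1 * p.2), Complex.I * (1 + p.2 ^ 2)) := by
  convert h.dpi_orbitFamily hk hp (γ := fun t => .ofSU (.hyp' t)) (by rw [hyp'_zero]; rfl)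
    (hasDerivAt_mult_ofSU n μ hyp'_zero hasDerivAt_hyp'_a hasDerivAt_hyp'_b p)
    (hasDerivAt_act_ofSU hyp'_zero hasDerivAt_hyp'_a hasDerivAt_hyp'_b p) using 3
  · simp
    ring
  · ext <;> simp <;> ring

theorem dpi_ofH_orbitFamily (h : IsExtremalWeight k μ π e₀) (hk : 2 * k = n) {p : ℂ × ℂ}
    (hp : p ∈ disk) (β : ℂ) :
    dpi π (fun t => .ofH (β * t) 0) (orbitFamily n μ π e₀ p) =
      (-(μ * conj β * p.1)) • orbitFamily n μ π e₀ p +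
        fderiv ℝ (orbitFamily n μ π e₀) p (β - conj β * p.2, 0) :=
  h.dpi_orbitFamily hk hp (by simp only [Complex.ofReal_zero, mul_zero]; rfl)
    (hasDerivAt_mult_ofH n μ β p) (hasDerivAt_act_ofH β p)

theorem dpi_ofH_real_orbitFamily (h : IsExtremalWeight k μ π e₀) (hk : 2 * k = n) {p : ℂ × ℂ}
    (hp : p ∈ disk) :
    dpi π (fun t => .ofH t 0) (orbitFamily n μ π e₀ p) =
      (-(μ * p.1)) • orbitFamily n μ π e₀ p +
        fderiv ℝ (orbitFamily n μ π e₀) p (1 - p.2, 0) := by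
  simpa using h.dpi_ofH_orbitFamily hk hp 1

/-- At the origin the multiplier terms vanish, so `a e₀ = 0` and `K₋ e₀ = 0` say that the real
differential is complex-linear in z and in w respectively. -/
theorem differentiableAt_orbitFamily_zero (h : IsExtremalWeight k μ π e₀) (hk : 2 * k = n)
    (hμ : 0 < μ) : DifferentiableAt ℂ (orbitFamily n μ π e₀) 0 := by
  have hE : HasFDerivAt (orbitFamily n μ π e₀) (fderiv ℝ (orbitFamily n μ π e₀) 0) 0 :=
    ((h.contDiffOn_orbitFamily.differentiableOn (by simp)).differentiableAt
      (isOpen_disk.mem_nhds zero_mem_disk)).hasFDerivAt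
  have h1 := h.dpi_ofH_real_orbitFamily hk zero_mem_disk
  have h2 := h.dpi_ofH_orbitFamily hk zero_mem_disk Complex.I
  have h3 := h.dpi_hyp_orbitFamily hk zero_mem_disk
  have h4 := h.dpi_hyp'_orbitFamily hk zero_mem_disk
  simp only [orbitFamily_zero] at h1 h2 h3 h4
  set L := fderiv ℝ (orbitFamily n μ π e₀) 0
  simp at h1 h2 h3 h4
  have ha := h.annihilation_eq
  have hK := h.Kminus_eq
  have hs : (Real.sqrt μ : ℂ) ≠ 0 := by exact_mod_cast (Real.sqrt_pos.2 hμ).ne'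
  rw [annihilation, h1, h2, smul_eq_zero_iff_right (by simpa using hs)] at ha
  rw [Kminus, h3, h4, smul_eq_zero_iff_right (by norm_num)] at hK
  have hz : L (Complex.I, 0) = Complex.I • L (1, 0) := by
    rw [eq_neg_of_add_eq_zero_left ha, smul_neg, smul_smul, Complex.I_mul_I]
    simp
  have hw : L (0, Complex.I) = Complex.I • L (0, 1) := by
    rw [eq_neg_of_add_eq_zero_left hK, smul_neg, smul_smul, Complex.I_mul_I]
    simp
  have hz' := eq_smul_of_map_I (L.comp (ContinuousLinearMap.inl ℝ ℂ ℂ)) (by simpa using hz)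
  have hw' := eq_smul_of_map_I (L.comp (ContinuousLinearMap.inr ℝ ℂ ℂ)) (by simpa using hw)
  refine (hasFDerivAt_of_restrictScalars ℝ
    (f' := (ContinuousLinearMap.fst ℂ ℂ ℂ).smulRight (L (1, 0)) +
      (ContinuousLinearMap.snd ℂ ℂ ℂ).smulRight (L (0, 1))) hE ?_).differentiableAt
  ext q
  · simpa using (hz' q).symm
  · simpa using (hw' q).symm

/-- With y moving p to the origin, equivariance writes the family near p as π(y⁻¹) applied to a
holomorphic scalar times the family at the holomorphically moved point. -/
theorem differentiableOn_orbitFamily (h : IsExtremalWeight k μ π e₀) (hk : 2 * k = n)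
    (hμ : 0 < μ) : DifferentiableOn ℂ (orbitFamily n μ π e₀) disk := by
  intro p hp
  have hnhds := isOpen_disk.mem_nhds hp
  refine DifferentiableAt.differentiableWithinAt ?_
  set y := (lift p)⁻¹
  have hy : act y p = 0 := by
    have h1 := act_mul y (lift p) zero_mem_disk
    rwa [inv_mul_cancel, act_one, act_lift hp, eq_comm] at h1
  have h0 : DifferentiableAt ℂ (orbitFamily n μ π e₀) (act y p) := by
    rw [hy]
    exact h.differentiableAt_orbitFamily_zero hk hμ
  have h1 := ((differentiableOn_mult n μ y).differentiableAt hnhds).smul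
    (h0.comp p ((differentiableOn_act y).differentiableAt hnhds))
  have h2 := ((π y⁻¹ : H →L[ℂ] H).differentiableAt).comp p h1
  refine h2.congr_of_eventuallyEq ?_
  filter_upwards [hnhds] with q hq
  have h3 := congrArg (π y⁻¹ : H →L[ℂ] H) (h.apply_orbitFamily hk y hq)
  rw [← map_mul_apply, inv_mul_cancel] at h3
  simpa using h3

/-- In the combinations defining a† and K₊ the multipliers cancel, as do the parts of the vector
fields depending on p, leaving ∂/∂z and ∂/∂w. -/
theorem raising_orbitFamily (h : IsExtremalWeight k μ π e₀) (hk : 2 * k = n) (hμ : 0 < μ)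
    {p : ℂ × ℂ} (hp : p ∈ disk) (z w : ℂ) :
    raising μ π z w (orbitFamily n μ π e₀ p) = fderiv ℂ (orbitFamily n μ π e₀) p (z, w) := by
  have hd := (h.differentiableOn_orbitFamily hk hμ).differentiableAt (isOpen_disk.mem_nhds hp)
  have hL : ∀ ξ : ℂ × ℂ, fderiv ℝ (orbitFamily n μ π e₀) p ξ =
      ξ.1 • fderiv ℂ (orbitFamily n μ π e₀) p (1, 0) +
        ξ.2 • fderiv ℂ (orbitFamily n μ π e₀) p (0, 1) := fun ξ => by
    rw [hd.fderiv_restrictScalars ℝ, ContinuousLinearMap.coe_restrictScalars', ← map_smul,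
      ← map_smul, ← map_add]
    simp
  have hz : fderiv ℂ (orbitFamily n μ π e₀) p (z, w) =
      z • fderiv ℂ (orbitFamily n μ π e₀) p (1, 0) +
        w • fderiv ℂ (orbitFamily n μ π e₀) p (0, 1) := by
    rw [← map_smul, ← map_smul, ← map_add]
    simp
  rw [raising, mul_comm, mul_smul, smul_creation hμ, Kplus, h.dpi_ofH_real_orbitFamily hk hp,
    h.dpi_ofH_orbitFamily hk hp, h.dpi_hyp_orbitFamily hk hp, h.dpi_hyp'_orbitFamily hk hp, hz]
  simp only [hL, Complex.conj_I]
  match_scalars <;> ring_nf <;> simp only [Complex.I_sq] <;> ring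

end IsExtremalWeight

end Representation

/-! ### Commutation of the derived representation with the complex derivative -/

/-- Mixed partial derivatives of a smooth function on `ℂ × ℝ` commute. -/
theorem hasDerivAt_mixed {F : Type*} [NormedAddCommGroup F] [NormedSpace ℝ F] {Φ : ℂ × ℝ → F}
    {s : ℂ} (hΦ : ContDiffAt ℝ ∞ Φ (s, 0)) :
    ∃ d : F, HasDerivAt (fun t : ℝ => fderiv ℝ Φ (s, t) (1, 0)) d 0 ∧
      HasDerivAt (fun t : ℝ => fderiv ℝ Φ (s + t, 0) (0, 1)) d 0 := by
  have h2 : HasFDerivAt (fderiv ℝ Φ) (fderiv ℝ (fderiv ℝ Φ) (s, 0)) (s, 0) :=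
    ((hΦ.fderiv_right (m := ∞) (by simp)).differentiableAt (by simp)).hasFDerivAt
  have hsymm := hΦ.isSymmSndFDerivAt (by
    rw [minSmoothness_of_isRCLikeNormedField]
    exact WithTop.coe_le_coe.2 le_top) (0, 1) (1, 0)
  have hc : HasDerivAt (fun t : ℝ => (s, t)) ((0 : ℂ), (1 : ℝ)) 0 :=
    (hasDerivAt_const _ _).prodMk (hasDerivAt_id _)
  have hr : HasDerivAt (fun t : ℝ => (s + t, (0 : ℝ))) ((1 : ℂ), (0 : ℝ)) 0 :=
    ((Complex.ofRealCLM.hasDerivAt (x := (0 : ℝ))).const_add s).prodMk (hasDerivAt_const _ _)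
  refine ⟨_, (h2.comp_hasDerivAt (0 : ℝ) hc).clm_apply (hasDerivAt_const _ ((1 : ℂ), (0 : ℝ))), ?_⟩
  have h2' : HasFDerivAt (fderiv ℝ Φ) (fderiv ℝ (fderiv ℝ Φ) (s, 0)) (s + (0 : ℝ), (0 : ℝ)) := by
    simpa using h2
  refine ((HasFDerivAt.comp_hasDerivAt (f := fun t : ℝ => (s + (t : ℂ), (0 : ℝ))) (0 : ℝ) h2'
    hr).clm_apply
    (hasDerivAt_const _ ((0 : ℂ), (1 : ℝ)))).congr_deriv ?_
  simpa using hsymm.symm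

theorem hasDerivAt_comp_add_real {F : Type*} [NormedAddCommGroup F] [NormedSpace ℂ F]
    {G : ℂ → F} {G' : F} {s : ℂ} (hG : HasDerivAt G G' s) :
    HasDerivAt (fun t : ℝ => G (s + t)) G' 0 := by
  have hr : HasDerivAt (fun t : ℝ => s + (t : ℂ)) 1 0 :=
    (Complex.ofRealCLM.hasDerivAt (x := (0 : ℝ))).const_add s
  have hG' : HasDerivAt G G' (s + (0 : ℝ)) := by simpa using hG
  simpa [Function.comp_def] using hG'.scomp (0 : ℝ) hr

section Representation

variable {H : Type*} [NormedAddCommGroup H] [InnerProductSpace ℂ H] [CompleteSpace H]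
  {π : JacobiGroup →* unitary (H →L[ℂ] H)} {e₀ : H} {k μ : ℝ} {n : ℕ}

/-- A holomorphic family of vectors all of whose orbits are jointly smooth. -/
structure IsSmoothHolomorphic (π : JacobiGroup →* unitary (H →L[ℂ] H)) (B : Set ℂ) (G : ℂ → H) :
    Prop where
  isOpen : IsOpen B
  differentiableOn : DifferentiableOn ℂ G B
  contDiffOn : ∀ γ : ℝ → JacobiGroup, SmoothFamilyOn γ Set.univ →
    ContDiffOn ℝ ∞ (fun q : ℂ × ℝ => (π (γ q.2) : H →L[ℂ] H) (G q.1)) (B ×ˢ Set.univ)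

namespace IsSmoothHolomorphic

variable {B : Set ℂ} {G : ℂ → H}

/-- Each π(γ t) is bounded, and the complex derivative is the derivative in the real direction 1.
The right-hand side is visibly smooth in (s, t), so the class is closed under `deriv`. -/
theorem apply_deriv (h : IsSmoothHolomorphic π B G) {γ : ℝ → JacobiGroup}
    (hγ : SmoothFamilyOn γ Set.univ) {s : ℂ} (hs : s ∈ B) (t : ℝ) :
    (π (γ t) : H →L[ℂ] H) (deriv G s) =
      fderiv ℝ (fun q : ℂ × ℝ => (π (γ q.2) : H →L[ℂ] H) (G q.1)) (s, t) (1, 0) := by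
  have ho : IsOpen (B ×ˢ (Set.univ : Set ℝ)) := h.isOpen.prod isOpen_univ
  have h1 : HasDerivAt G (deriv G s) s :=
    (h.differentiableOn.differentiableAt (h.isOpen.mem_nhds hs)).hasDerivAt
  have h2 := ((π (γ t) : H →L[ℂ] H).restrictScalars ℝ).hasFDerivAt.comp_hasDerivAt (0 : ℝ)
    (hasDerivAt_comp_add_real h1)
  have h3 : HasFDerivAt (fun q : ℂ × ℝ => (π (γ q.2) : H →L[ℂ] H) (G q.1))
      (fderiv ℝ (fun q : ℂ × ℝ => (π (γ q.2) : H →L[ℂ] H) (G q.1)) (s, t)) (s + (0 : ℝ), t) := by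
    rw [Complex.ofReal_zero, add_zero]
    exact (((h.contDiffOn γ hγ).differentiableOn (by simp)).differentiableAt
      (ho.mem_nhds ⟨hs, trivial⟩)).hasFDerivAt
  have hr : HasDerivAt (fun r : ℝ => (s + r, t)) ((1 : ℂ), (0 : ℝ)) 0 :=
    ((Complex.ofRealCLM.hasDerivAt (x := (0 : ℝ))).const_add s).prodMk (hasDerivAt_const _ _)
  exact h2.unique (h3.comp_hasDerivAt (0 : ℝ) hr)

theorem dpi_eq (h : IsSmoothHolomorphic π B G) {γ : ℝ → JacobiGroup}
    (hγ : SmoothFamilyOn γ Set.univ) {s : ℂ} (hs : s ∈ B) :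
    dpi π γ (G s) =
      fderiv ℝ (fun q : ℂ × ℝ => (π (γ q.2) : H →L[ℂ] H) (G q.1)) (s, 0) (0, 1) := by
  have ho : IsOpen (B ×ˢ (Set.univ : Set ℝ)) := h.isOpen.prod isOpen_univ
  have h3 := (((h.contDiffOn γ hγ).differentiableOn (by simp)).differentiableAt
      (ho.mem_nhds (x := (s, (0 : ℝ))) ⟨hs, trivial⟩)).hasFDerivAt
  have hc : HasDerivAt (fun t : ℝ => (s, t)) ((0 : ℂ), (1 : ℝ)) 0 :=
    (hasDerivAt_const _ _).prodMk (hasDerivAt_id _)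
  exact (h3.comp_hasDerivAt (0 : ℝ) hc).deriv

protected theorem deriv (h : IsSmoothHolomorphic π B G) : IsSmoothHolomorphic π B (deriv G) where
  isOpen := h.isOpen
  differentiableOn := h.differentiableOn.deriv h.isOpen
  contDiffOn γ hγ := by
    have ho : IsOpen (B ×ˢ (Set.univ : Set ℝ)) := h.isOpen.prod isOpen_univ
    refine (((h.contDiffOn γ hγ).fderiv_of_isOpen (m := ∞) ho (by simp)).clm_apply
      (contDiffOn_const (c := ((1 : ℂ), (0 : ℝ))))).congr fun q hq => ?_
    exact h.apply_deriv hγ hq.1 q.2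

/-- The derived representation commutes with the derivative of a smooth holomorphic family. -/
theorem hasDerivAt_dpi (h : IsSmoothHolomorphic π B G) {γ : ℝ → JacobiGroup}
    (hγ : SmoothFamilyOn γ Set.univ) {s : ℂ} (hs : s ∈ B) :
    HasDerivAt (fun t : ℝ => dpi π γ (G (s + t))) (dpi π γ (deriv G s)) 0 := by
  have ho : IsOpen (B ×ˢ (Set.univ : Set ℝ)) := h.isOpen.prod isOpen_univ
  obtain ⟨d, h1, h2⟩ := hasDerivAt_mixed ((h.contDiffOn γ hγ).contDiffAt
    (ho.mem_nhds (x := (s, (0 : ℝ))) ⟨hs, trivial⟩))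
  have hd : dpi π γ (deriv G s) = d := by
    rw [← h1.deriv, dpi]
    exact congrArg (fun f => deriv f 0) (funext fun t => h.apply_deriv hγ hs t)
  rw [hd]
  refine h2.congr_of_eventuallyEq ?_
  have hc : ContinuousAt (fun t : ℝ => s + (t : ℂ)) 0 := by fun_prop
  have hB : B ∈ nhds (s + ((0 : ℝ) : ℂ)) := by simpa using h.isOpen.mem_nhds hs
  filter_upwards [hc.preimage_mem_nhds hB] with t ht
  exact h.dpi_eq hγ ht

/-- Differentiate the hypothesis in s: the unbounded operator passes through the derivative by
`hasDerivAt_dpi`. This reproduces the hypothesis for `deriv G` and drives the induction in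
`iterate_raising`. -/
theorem raising_deriv (h : IsSmoothHolomorphic π B G) {z w : ℂ}
    (hG : ∀ s ∈ B, raising μ π z w (G s) = deriv G s) {s : ℂ} (hs : s ∈ B) :
    raising μ π z w (deriv G s) = deriv (deriv G) s := by
  have h1 : HasDerivAt (fun t : ℝ => raising μ π z w (G (s + t)))
      (raising μ π z w (deriv G s)) 0 := by
    refine HasDerivAt.add (HasDerivAt.const_smul _ (HasDerivAt.const_smul _ (HasDerivAt.sub ?_
      (HasDerivAt.const_smul _ ?_)))) (HasDerivAt.const_smul _ (HasDerivAt.const_smul _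
      (HasDerivAt.sub ?_ (HasDerivAt.const_smul _ ?_))))
    · exact h.hasDerivAt_dpi smoothFamilyOn_ofH_real hs
    · exact h.hasDerivAt_dpi smoothFamilyOn_ofH_imag hs
    · exact h.hasDerivAt_dpi smoothFamilyOn_hyp hs
    · exact h.hasDerivAt_dpi smoothFamilyOn_hyp' hs
  have h2 := hasDerivAt_comp_add_real
    (h.deriv.differentiableOn.differentiableAt (h.isOpen.mem_nhds hs)).hasDerivAt
  refine h1.unique (h2.congr_of_eventuallyEq ?_)
  have hc : ContinuousAt (fun t : ℝ => s + (t : ℂ)) 0 := by fun_prop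
  have hB : B ∈ nhds (s + ((0 : ℝ) : ℂ)) := by simpa using h.isOpen.mem_nhds hs
  filter_upwards [hc.preimage_mem_nhds hB] with t ht
  exact hG _ ht

theorem iterate_raising (h : IsSmoothHolomorphic π B G) {z w : ℂ}
    (hG : ∀ s ∈ B, raising μ π z w (G s) = deriv G s) {s : ℂ} (hs : s ∈ B) (j : ℕ) :
    (raising μ π z w)^[j] (G s) = deriv^[j] G s := by
  induction j generalizing G with
  | zero => rfl
  | succ j ih =>
    rw [Function.iterate_succ_apply, Function.iterate_succ_apply, hG s hs]
    exact ih h.deriv fun s hs => h.raising_deriv hG hs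

end IsSmoothHolomorphic

/-! ### Coherent vectors as Taylor series, and the transformation law -/

namespace IsExtremalWeight

theorem hasSum_coherentTerm (h : IsExtremalWeight k μ π e₀) (hk : 2 * k = n) (hμ : 0 < μ)
    {z w : ℂ} (hw : ‖w‖ < 1) :
    HasSum (coherentTerm μ π e₀ z w) (orbitFamily n μ π e₀ (z, w)) := by
  -- The radius must exceed 1 so that s = 1, where the Taylor series is summed, is interior, while
  -- (sz, sw) stays in the disk.
  obtain ⟨r, hr1, hr⟩ : ∃ r : ℝ, 1 < r ∧ r * ‖w‖ < 1 := by
    have hc : ContinuousAt (fun r : ℝ => r * ‖w‖) 1 := by fun_prop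
    have h1 := hc.eventually_lt_const (u := 1) (by simpa using hw)
    obtain ⟨r, hr⟩ := ((h1.filter_mono nhdsWithin_le_nhds).and
      (self_mem_nhdsWithin (s := Set.Ioi (1 : ℝ)))).exists
    exact ⟨r, hr.2, hr.1⟩
  have hmaps : ∀ s ∈ Metric.ball (0 : ℂ) r, (s * z, s * w) ∈ disk := fun s hs => by
    rw [mem_ball_zero_iff] at hs
    simp only [disk, Set.mem_ofPred_eq, norm_mul]
    exact (mul_le_mul_of_nonneg_right hs.le (norm_nonneg w)).trans_lt hr
  set F : ℂ → H := fun s => orbitFamily n μ π e₀ (s * z, s * w) with hF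
  have hline : ∀ s : ℂ, HasDerivAt (fun s : ℂ => (s * z, s * w)) (z, w) s := fun s => by
    simpa using ((hasDerivAt_id s).mul_const z).prodMk ((hasDerivAt_id s).mul_const w)
  have hd : ∀ s ∈ Metric.ball (0 : ℂ) r,
      HasDerivAt F (fderiv ℂ (orbitFamily n μ π e₀) (s * z, s * w) (z, w)) s := fun s hs =>
    HasFDerivAt.comp_hasDerivAt (f := fun s : ℂ => (s * z, s * w)) s
      ((h.differentiableOn_orbitFamily hk hμ).differentiableAt
        (isOpen_disk.mem_nhds (hmaps s hs))).hasFDerivAt (hline s)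
  have hS : IsSmoothHolomorphic π (Metric.ball 0 r) F :=
    { isOpen := Metric.isOpen_ball
      differentiableOn := fun s hs => (hd s hs).differentiableAt.differentiableWithinAt
      contDiffOn := fun γ hγ => h.contDiffOn_apply_orbitFamily
        (hγ.comp contDiff_snd.contDiffOn fun _ _ => trivial)
        ((contDiff_fst.mul contDiff_const).prodMk (contDiff_fst.mul contDiff_const)).contDiffOn
        fun q hq => hmaps q.1 hq.1 }
  have hR : ∀ s ∈ Metric.ball (0 : ℂ) r, raising μ π z w (F s) = deriv F s := fun s hs => by
    rw [(hd s hs).deriv]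
    exact h.raising_orbitFamily hk hμ (hmaps s hs) z w
  have h0 : (0 : ℂ) ∈ Metric.ball (0 : ℂ) r := by
    rw [mem_ball_zero_iff, norm_zero]
    linarith
  have h1 : (1 : ℂ) ∈ Metric.ball (0 : ℂ) r := by
    rw [mem_ball_zero_iff, norm_one]
    exact hr1
  have hT := Complex.hasSum_taylorSeries_on_ball hS.differentiableOn h1
  have hF0 : F 0 = e₀ := by
    simp only [hF, zero_mul]
    exact orbitFamily_zero
  convert hT using 1
  · funext j
    rw [iteratedDeriv_eq_iterate, ← hS.iterate_raising hR h0 j, hF0, sub_zero, one_pow, one_smul]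
    rfl
  · simp [hF]

theorem coherent_eq (h : IsExtremalWeight k μ π e₀) (hk : 2 * k = n) (hμ : 0 < μ)
    {z w : ℂ} (hw : ‖w‖ < 1) : coherent μ π e₀ z w = orbitFamily n μ π e₀ (z, w) :=
  (h.hasSum_coherentTerm hk hμ hw).tsum_eq

theorem T_eq (h : IsExtremalWeight k μ π e₀) (x : JacobiGroup) :
    T μ π x = (π x : H →L[ℂ] H) := by
  ext v
  -- Splitting off the centre last lets the central character produce the phase e^{iμt}.
  have hx : x = .ofSU x.g * (.ofH x.α 0 * .ofH 0 x.t) := by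
    ext <;> simp [JacobiGroup.ofSU, JacobiGroup.ofH, SU11.lin]
  conv_rhs => rw [hx, map_mul_apply, map_mul_apply, h.central, map_smul]
  rfl

theorem apply_coherent (h : IsExtremalWeight k μ π e₀) (hk : 2 * k = n) (hμ : 0 < μ)
    (x : JacobiGroup) {z w : ℂ} (hw : ‖w‖ < 1) :
    (π x : H →L[ℂ] H) (coherent μ π e₀ z w) =
      mult n μ x (z, w) • coherent μ π e₀ (z₁ x.g x.α z w) (w₁ x.g w) := by
  rw [h.coherent_eq hk hμ hw, h.coherent_eq hk hμ (norm_w₁_lt x.g hw),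
    h.apply_orbitFamily hk x (p := (z, w)) hw]
  rfl

end IsExtremalWeight

theorem S_comp_D (π : JacobiGroup →* unitary (H →L[ℂ] H)) (g : SU11) (α : ℂ) (v : H) :
    S π g (D π α v) = (π ⟨g, α, 0⟩ : H →L[ℂ] H) v := by
  have hx : (⟨g, α, 0⟩ : JacobiGroup) = .ofSU g * .ofH α 0 := by
    ext <;> simp [JacobiGroup.ofSU, JacobiGroup.ofH, SU11.lin]
  rw [hx, map_mul_apply]
  rfl

end Representation

end SiegelJacobi

end

open SiegelJacobi in
theorem proposition1 :
    -- the holomorphic, transitive action of the Jacobi group on the Siegel-Jacobi disk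
    ((∀ (x : JacobiGroup), ∀ p ∈ disk, delta x.g p.2 ≠ 0 ∧ act x p ∈ disk) ∧
      (∀ p ∈ disk, act 1 p = p) ∧
      (∀ (x y : JacobiGroup), ∀ p ∈ disk, act (x * y) p = act x (act y p)) ∧
      ContinuousOn (fun q : JacobiGroup × (ℂ × ℂ) => act q.1 q.2) (Set.univ ×ˢ disk) ∧
      (∀ x : JacobiGroup, DifferentiableOn ℂ (act x) disk) ∧
      (∀ p ∈ disk, ∀ q ∈ disk, ∃ x : JacobiGroup, act x p = q) ∧
      (∀ x : JacobiGroup, (∀ p ∈ disk, act x p = p) ↔ ∃ t : ℝ, x = .ofH 0 t)) ∧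
    -- the action of the representation on the coherent vectors
    ∀ (n : ℕ) (k μ : ℝ), 2 ≤ n → 2 * k = n → 0 < μ →
      ∀ {H : Type*} [NormedAddCommGroup H] [InnerProductSpace ℂ H] [CompleteSpace H]
        (π : JacobiGroup →* unitary (H →L[ℂ] H)) (e₀ : H), IsExtremalWeight k μ π e₀ →
        (∀ (α : ℂ) (v : H), IsSmoothVector π v →
          HasDerivAt (fun s : ℝ => D π (s * α) v)
            ((Real.sqrt μ : ℂ) • (α • creation μ π v - (starRingEnd ℂ) α • annihilation μ π v))
            0) ∧
        (∀ x : JacobiGroup, T μ π x = (π x : H →L[ℂ] H)) ∧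
        (∀ z w : ℂ, ‖w‖ < 1 →
          (∀ j : ℕ, IsSmoothVector π (coherentTerm μ π e₀ z w j)) ∧
          HasSum (coherentTerm μ π e₀ z w) (coherent μ π e₀ z w)) ∧
        (∀ (g : SU11) (α z w : ℂ), ‖w‖ < 1 →
          S π g (D π α (coherent μ π e₀ z w)) =
            lam n μ g α z w • coherent μ π e₀ (z₁ g α z w) (w₁ g w)) ∧
        (∀ (g : SU11) (α : ℂ) (t : ℝ) (z w : ℂ), ‖w‖ < 1 →
          T μ π ⟨g, α, t⟩ (coherent μ π e₀ z w) =
            (lam n μ g α z w * Complex.exp (Complex.I * μ * t)) •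
              coherent μ π e₀ (z₁ g α z w) (w₁ g w)) := by
  refine ⟨⟨fun x p hp => ⟨delta_ne_zero x.g hp, act_mem_disk x hp⟩, fun p _ => act_one p,
    fun x y p hp => act_mul x y hp, continuousOn_act, differentiableOn_act,
    fun p hp q hq => act_transitive hp hq, act_eq_self_iff⟩, ?_⟩
  intro n k μ _ hk hμ H _ _ _ π e₀ h
  refine ⟨fun α v hv => hv.hasDerivAt_D hμ α, h.T_eq, fun z w hw =>
    ⟨h.smooth.coherentTerm μ z w, ?_⟩, fun g α z w hw => ?_, fun g α t z w hw => ?_⟩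
  · rw [h.coherent_eq hk hμ hw]
    exact h.hasSum_coherentTerm hk hμ hw
  · rw [S_comp_D, h.apply_coherent hk hμ _ hw]
    simp [mult]
  · rw [h.T_eq, h.apply_coherent hk hμ _ hw, mult]
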